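/- \textbf{Setting.} Let $R$ be an integral domain with field of fractions $\mathbb F$. A \emph{cellular basis} of a unital $R$-algebra $A$ with an algebra involution $*$ ($R$-linear, anti-multiplicative, of order dividing $2$), with respect to a finite poset $(\widehat A,\unrhd)$ and finite index sets $\mathrm{Std}(\lambda)$, $\lambda\in\widehat A$, is an $R$-basis $\{c^\lambda_{st} : \lambda\in\widehat A,\ s,t\in \mathrm{Std}(\lambda)\}$ such that, with $A^{\rhd\lambda}=\mathrm{span}\{c^\mu_{uv}:\mu\rhd\lambda\}$, (a) for all $\lambda$, $t\in\mathrm{Std}(\lambda)$ and $a\in A$ there are $r(a;t,v)\in R$ with $c^\lambda_{st}a\equiv\sum_v r(a;t,v)c^\lambda_{sv} \bmod A^{\rhd\lambda}$ for all $s$; (b) $(c^\lambda_{st})^*\equiv c^\lambda_{ts} \bmod A^{\rhd\lambda}$. The cell module $\Delta(\lambda)$ is the right $A$-module with $R$-basis $\{c_t: t\in\mathrm{Std}(\lambda)\}$ and action $c_ta=\sum_v r(a;t,v)c_v$. Put $A^{\unrhd\lambda}=\mathrm{span}\{c^\mu_{uv}:\mu\unrhd\lambda\}$. A cell filtration of a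 right $A$-module $M$ is a filtration $0=M_0\subseteq\dots\subseteq M_s=M$ by submodules with $M_i/M_{i-1}\cong\Delta(\lambda^{(i)})$; it is order preserving if $\lambda^{(1)}\rhd\lambda^{(2)}\rhd\cdots\rhd\lambda^{(s)}$. Let $(A_r)_{r\ge0}$ be an increasing sequence of algebras over $R$, each with a cellular basis (with posets $\widehat A_r$, non-empty index sets, and cell modules $\Delta_r(\lambda)$), with unital inclusions and consistent involutions, such that: (D1) $A_0=R$. (D2) Every cell module is cyclic. For every $r$ and $\lambda\in\widehat A_r$ fix a generator $\delta_r(\lambda)$ of $\Delta_r(\lambda)$, an isomorphism of $A_r$-bimodules $\alpha_\lambda:A_r^{\unrhd\lambda}/A_r^{\rhd\lambda}\to\Delta_r(\lambda)^*\otimes_R\Delta_r(\lambda)$, and $m_\lambda\in A_r^{\unrhd\lambda}$ with $\alpha_\lambda(m_\lambda+A_r^{\rhd\lambda})=\delta_r(\lambda)^*\otimes\delta_r(\lambda)$. (Here $\Delta_r(\lambda)^*$ is $\Delta_r(\lambda)$ made into a left module through $*$.) (D3) $m_\lambda^*=m_\lambda$. (D4) $A_r^{\mathbb F}=A_r\otimes_R\mathbb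 F$ is split semisimple for all $r$. (D5) For every $r$ and $\mu\in\widehat A_{r+1}$, the restriction of $\Delta_{r+1}(\mu)$ to $A_r$ has an order preserving cell filtration. The branching diagram has vertex set $\bigsqcup_r\widehat A_r$ and an edge $\lambda\to\mu$ ($\lambda\in\widehat A_r$, $\mu\in\widehat A_{r+1}$) if and only if $\Delta_r(\lambda)$ occurs as a subquotient of an order preserving cell filtration of the restriction of $\Delta_{r+1}(\mu)$; $\varnothing$ is the unique element of $\widehat A_0$. For each edge $\lambda\to\mu$ fix a branching factor $d_{\lambda\to\mu}\in A_{r+1}$: if $M_{j}/M_{j-1}\cong\Delta_r(\lambda)$ is the corresponding step of such a filtration, then $\delta_{r+1}(\mu)d_{\lambda\to\mu}\in M_j$ and its class in $M_j/M_{j-1}$ corresponds to $\delta_r(\lambda)$ under the isomorphism. (D6) For each edge $\lambda\to\mu$ there is $u_{\lambda\to\mu}\in A_{r+1}$ with $m_\mu d_{\lambda\to\mu}=(u_{\lambda\to\mu})^*m_\lambda$. For $\lambda\in\widehat A_r$ let $\mathrm{Std}_r(\lambda)$ be the set of directed paths $t=(\varnothing=t(0)\to t(1)\to\cdots\to t(r)=\lambda)$.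 For $s,t\in\mathrm{Std}_r(\lambda)$ put $d_t=d_{t(r-1)\to t(r)}\cdots d_{t(0)\to t(1)}$, $m^\lambda_{st}=d_s^*m_\lambda d_t\in A_r$, and $m^\lambda_t=\delta_r(\lambda)d_t\in\Delta_r(\lambda)$ (equivalently, $m^\lambda_t$ is the class of $m_\lambda d_t$ in $(m_\lambda A_r+A_r^{\rhd\lambda})/A_r^{\rhd\lambda}\cong\Delta_r(\lambda)$). Let $\Delta^{\mathbb F}_r(\lambda)=\Delta_r(\lambda)\otimes_R\mathbb F$, and let $z^\lambda_r$ be the minimal central idempotent of $A_r^{\mathbb F}$ acting as the identity on $\Delta^{\mathbb F}_r(\lambda)$. Put $F_t=\prod_{i=1}^r z_i^{t(i)}\in A_r^{\mathbb F}$, and $$f^\lambda_t=m^\lambda_tF_t\in\Delta^{\mathbb F}_r(\lambda),\qquad F^\lambda_{st}=F_s\,m^\lambda_{st}\,F_t\in A_r^{\mathbb F}.$$ \textbf{Statement.} For every $r\ge0$: (1) for every $\lambda\in\widehat A_r$, $\{f^\lambda_t : t\in\mathrm{Std}_r(\lambda)\}$ is a basis of $\Delta^{\mathbb F}_r(\lambda)$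 over $\mathbb F$; (2) $\{F^\lambda_{st} : \lambda\in\widehat A_r,\ s,t\in\mathrm{Std}_r(\lambda)\}$ is a cellular basis of $A_r^{\mathbb F}$ with respect to the $\mathbb F$-linear extension of the involution $*$ of $A_r$, the poset $(\widehat A_r,\unrhd)$ and the index sets $\mathrm{Std}_r(\lambda)$. -/

import Mathlib

open scoped TensorProduct

noncomputable section

universe uR uF uA uL uS

/-! ### Cellular algebras -/

namespace Cellular

section Basis

variable {R : Type*} {A : Type*} [CommRing R] [Ring A] [Algebra R A]
  {L : Type*} [PartialOrder L] {S : L → Type*}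

/-- The span `A^{▷ l}` of the elements `c k s t` with `k ▷ l`.
The order is written so that `k ⊵ l` is `l ≤ k`. -/
def spanGT (R : Type*) {A : Type*} [CommRing R] [Ring A] [Algebra R A]
    {L : Type*} [PartialOrder L] {S : L → Type*}
    (c : ∀ l, S l → S l → A) (l : L) : Submodule R A :=
  Submodule.span R {x | ∃ k, l < k ∧ ∃ s t : S k, x = c k s t}

/-- The span `A^{⊵ l}` of the elements `c k s t` with `k ⊵ l`. -/
def spanGE (R : Type*) {A : Type*} [CommRing R] [Ring A] [Algebra R A]
    {L : Type*} [PartialOrder L] {S : L → Type*}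
    (c : ∀ l, S l → S l → A) (l : L) : Submodule R A :=
  Submodule.span R {x | ∃ k, l ≤ k ∧ ∃ s t : S k, x = c k s t}

/-- The family `c l s t` (`l ∈ L`, `s t ∈ S l`) is a cellular basis of the `R`-algebra `A` with
respect to the algebra involution `inv`, the poset `L` and the index sets `S l`, that is,
`(A, inv, L, ⊵, S, c)` is a cell datum. -/
structure IsCellularBasis (inv : A →ₗ[R] A) (c : ∀ l, S l → S l → A) : Prop where
  inv_mul : ∀ a b, inv (a * b) = inv b * inv a
  inv_inv : ∀ a, inv (inv a) = a
  finite_poset : Finite L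
  finite_index : ∀ l, Finite (S l)
  linearIndependent : LinearIndependent R (fun p : (Σ l, S l × S l) => c p.1 p.2.1 p.2.2)
  span_eq_top : Submodule.span R (Set.range fun p : (Σ l, S l × S l) => c p.1 p.2.1 p.2.2) = ⊤
  mul_mem : ∀ (l : L) (t : S l) (a : A), ∃ r : S l →₀ R, ∀ s : S l,
    c l s t * a - r.sum (fun v k => k • c l s v) ∈ spanGT R c l
  inv_mem : ∀ (l : L) (s t : S l), inv (c l s t) - c l t s ∈ spanGT R c l

end Basis

/-- A cell datum for the `R`-algebra `A`. -/
structure CellDatum (R : Type uR) (A : Type uA) [CommRing R] [Ring A] [Algebra R A] where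
  inv : A →ₗ[R] A
  Shape : Type uL
  [order : PartialOrder Shape]
  Idx : Shape → Type uS
  c : ∀ l, Idx l → Idx l → A
  isCellularBasis : IsCellularBasis inv c

attribute [instance] CellDatum.order

namespace CellDatum

variable {R : Type uR} {A : Type uA} [CommRing R] [Ring A] [Algebra R A]
  (D : CellDatum.{uR, uA, uL, uS} R A)

/-- The ideal `A^{▷ l}`. -/
def gt (l : D.Shape) : Submodule R A := spanGT R D.c l

/-- The ideal `A^{⊵ l}`. -/
def ge (l : D.Shape) : Submodule R A := spanGE R D.c l

/-- The cellular basis, as a basis of the `R`-module `A`. -/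
def basis : Module.Basis (Σ l, D.Idx l × D.Idx l) R A :=
  Module.Basis.mk D.isCellularBasis.linearIndependent D.isCellularBasis.span_eq_top.ge

/-- The cell module `Δ(l)`: the free `R`-module on the index set of `l`. -/
abbrev CellModule (l : D.Shape) : Type _ := D.Idx l →₀ R

theorem row_injective {l : D.Shape} (s : D.Idx l) : Function.Injective
    (fun v : D.Idx l => (⟨l, (s, v)⟩ : Σ l, D.Idx l × D.Idx l)) := by
  intro v w h
  simpa using h

/-- The element `c_t · a = ∑ v, r(a; t, v) c_v` of the cell module, linearly in `a`. The structure
constant `r(a; t, v)` is the coefficient of the basis element `c l t v` in `c l t t * a`. -/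
def actBasis {l : D.Shape} (t : D.Idx l) : A →ₗ[R] D.CellModule l :=
  Finsupp.lcomapDomain _ (D.row_injective t) ∘ₗ D.basis.repr.toLinearMap ∘ₗ
    LinearMap.mulLeft R (D.c l t t)

/-- The right action of `A` on the cell module: `D.act l a x` is `x · a`. -/
def act (l : D.Shape) : A →ₗ[R] Module.End R (D.CellModule l) :=
  LinearMap.flip (Finsupp.lift (A →ₗ[R] D.CellModule l) R (D.Idx l) D.actBasis)

open Classical in
/-- The coefficients used in `actBasis` are the ones of the cellular algebra axiom. -/
theorem actBasis_spec {l : D.Shape} (s t : D.Idx l) (a : A) :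
    D.c l s t * a - (D.actBasis t a).sum (fun v k => k • D.c l s v) ∈ D.gt l := by
  obtain ⟨r, hr⟩ := D.isCellularBasis.mul_mem l t a
  have hb : ∀ (k : D.Shape) (u w : D.Idx k), D.c k u w = D.basis ⟨k, (u, w)⟩ := by
    intro k u w; simp [basis]
  have hgt : ∀ x ∈ D.gt l, ∀ v : D.Idx l, D.basis.repr x ⟨l, (t, v)⟩ = 0 := by
    intro x hx v
    induction hx using Submodule.span_induction with
    | mem x hx =>
      obtain ⟨k, hk, u, w, rfl⟩ := hx
      rw [hb, Module.Basis.repr_self, Finsupp.single_apply, if_neg]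
      intro h
      exact hk.ne' (congrArg Sigma.fst h)
    | zero => simp
    | add x y _ _ hx hy => simp [hx, hy]
    | smul c x _ hx => simp [hx]
  have hact : D.actBasis t a = r := by
    ext v
    have h := hgt _ (hr t) v
    rw [map_sub, Finsupp.sub_apply, sub_eq_zero] at h
    change D.basis.repr (D.c l t t * a) ⟨l, (t, v)⟩ = r v
    rw [h, Finsupp.sum, map_sum, Finsupp.finsetSum_apply, Finset.sum_eq_single v]
    · simp [hb]
    · intro w _ hw
      rw [map_smul, hb, Module.Basis.repr_self, Finsupp.smul_apply, Finsupp.single_apply, if_neg]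
      · simp
      · intro h
        exact hw (D.row_injective t h)
    · intro hv
      simp [Finsupp.notMem_support_iff.mp hv]
  rw [hact]
  exact hr s

theorem act_single {l : D.Shape} (t : D.Idx l) (a : A) :
    D.act l a (Finsupp.single t 1) = D.actBasis t a := by
  simp [act]

/-- A bimodule isomorphism `A^{⊵ l} / A^{▷ l} → Δ(l)* ⊗ Δ(l)`. The underlying module of
`Δ(l)*` is that of `Δ(l)`, with left action `a · x* = (x · a*)*`. -/
structure BimoduleIso (l : D.Shape) where
  toEquiv : (D.ge l ⧸ (D.gt l).submoduleOf (D.ge l)) ≃ₗ[R] D.CellModule l ⊗[R] D.CellModule l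
  map_mul : ∀ (a b : A) (x y : D.ge l), (y : A) = a * x * b →
    toEquiv (Submodule.Quotient.mk y) =
      TensorProduct.map (D.act l (D.inv a)) (D.act l b) (toEquiv (Submodule.Quotient.mk x))

/-- A cell filtration `0 = M 0 ⊆ M 1 ⊆ ⋯ ⊆ M len = V` of a right `A`-module `V`, whose action is
given by `ρ`, with chosen isomorphisms of right `A`-modules `M (i + 1) / M i ≅ Δ(shape i)`. -/
structure CellFiltration {V : Type*} [AddCommGroup V] [Module R V]
    (ρ : A →ₗ[R] Module.End R V) where
  len : ℕ
  M : Fin (len + 1) → Submodule R V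
  bot : M 0 = ⊥
  top : M (Fin.last len) = ⊤
  mono : ∀ i : Fin len, M i.castSucc ≤ M i.succ
  stable : ∀ (i : Fin (len + 1)) (a : A), ∀ x ∈ M i, ρ a x ∈ M i
  shape : Fin len → D.Shape
  iso : ∀ i : Fin len,
    (M i.succ ⧸ (M i.castSucc).submoduleOf (M i.succ)) ≃ₗ[R] D.CellModule (shape i)
  iso_act : ∀ (i : Fin len) (a : A) (x : M i.succ),
    iso i (Submodule.Quotient.mk ⟨ρ a x, stable i.succ a x x.2⟩) =
      D.act (shape i) a (iso i (Submodule.Quotient.mk x))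

/-- The filtration is order preserving: `shape 0 ▷ shape 1 ▷ ⋯`. -/
def CellFiltration.OrderPreserving {D : CellDatum.{uR, uA, uL, uS} R A} {V : Type*} [AddCommGroup V] [Module R V]
    {ρ : A →ₗ[R] Module.End R V} (f : D.CellFiltration ρ) : Prop :=
  StrictAnti f.shape

/-- The right action of `A^F = F ⊗ A` on `Δ^F(l) = F ⊗ Δ(l)`:
`(x ⊗ v) · (y ⊗ a) = (x y) ⊗ (v · a)`. -/
def actBaseChange (F : Type*) [Field F] [Algebra R F] (l : D.Shape) :
    F ⊗[R] A →ₗ[F] Module.End F (F ⊗[R] D.CellModule l) :=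
  LinearMap.liftBaseChange F
    (LinearMap.baseChangeHom R F (D.CellModule l) (D.CellModule l) ∘ₗ D.act l)

end CellDatum

/-! ### Idempotents and split semisimplicity -/

/-- The `F`-algebra `A` is split semisimple: a finite product of matrix algebras over `F`. -/
def IsSplitSemisimple (F A : Type*) [Field F] [Ring A] [Algebra F A] : Prop :=
  ∃ (n : ℕ) (d : Fin n → ℕ), (∀ i, 0 < d i) ∧
    Nonempty (A ≃ₐ[F] (∀ i, Matrix (Fin (d i)) (Fin (d i)) F))

/-- A minimal central idempotent of a ring. -/
def IsMinimalCentralIdempotent {A : Type*} [Ring A] (e : A) : Prop :=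
  e ∈ Subring.center A ∧ e * e = e ∧ e ≠ 0 ∧
    ∀ e' ∈ Subring.center A, e' * e' = e' → e' * e = e' → e' = 0 ∨ e' = e

/-! ### Towers of cellular algebras -/

/-- An increasing sequence of cellular algebras over `R`, with unital inclusions and consistent
involutions. The index sets of the cell data are not empty. -/
structure CellularTower (R : Type uR) [CommRing R] where
  A : ℕ → Type uA
  [ring : ∀ r, Ring (A r)]
  [algebra : ∀ r, Algebra R (A r)]
  cell : ∀ r, CellDatum.{uR, uA, uL, uS} R (A r)
  nonempty_idx : ∀ r (l : (cell r).Shape), Nonempty ((cell r).Idx l)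
  incl : ∀ r, A r →ₐ[R] A (r + 1)
  incl_injective : ∀ r, Function.Injective (incl r)
  incl_inv : ∀ r x, incl r ((cell r).inv x) = (cell (r + 1)).inv (incl r x)

attribute [instance] CellularTower.ring CellularTower.algebra

namespace CellularTower

variable {R : Type uR} [CommRing R] (T : CellularTower.{uR, uA, uL, uS} R)

/-- The poset of the cell datum of `A r`. -/
abbrev Shape (r : ℕ) : Type _ := (T.cell r).Shape

/-- The cell module of `A r` of shape `l`. -/
abbrev CellModule {r : ℕ} (l : T.Shape r) : Type _ := (T.cell r).CellModule l

/-- The right action of `A r` on the restriction to `A r` of the cell module of shape `m` of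
`A (r + 1)`. -/
def resAct {r : ℕ} (m : T.Shape (r + 1)) : T.A r →ₗ[R] Module.End R (T.CellModule m) :=
  (T.cell (r + 1)).act m ∘ₗ (T.incl r).toLinearMap

/-- The tower is restriction-coherent. -/
def RestrictionCoherent : Prop :=
  ∀ (r : ℕ) (m : T.Shape (r + 1)),
    ∃ f : (T.cell r).CellFiltration (T.resAct m), f.OrderPreserving

/-- There is an edge `l → m` in the branching diagram when `Δ(l)` is a subquotient of an order
preserving cell filtration of the restriction of `Δ(m)`. -/
def Edge {r : ℕ} (l : T.Shape r) (m : T.Shape (r + 1)) : Prop :=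
  ∃ f : (T.cell r).CellFiltration (T.resAct m), f.OrderPreserving ∧ ∃ i, f.shape i = l

/-- Paths of length `r` in the branching diagram from level `0` to `l`, that is, standard tableaux
of shape `l`. (In the towers considered below level `0` has a single vertex.) -/
inductive Path : ∀ r : ℕ, T.Shape r → Type uL
  | nil (l : T.Shape 0) : Path 0 l
  | snoc {r : ℕ} {l : T.Shape r} {m : T.Shape (r + 1)} (t : Path r l) (h : T.Edge l m) :
      Path (r + 1) m

/-- Given generators `δ` of the cell modules, the element `d` is a branching factor for
`l → m`: for an order preserving cell filtration of the restriction of `Δ(m)`, and a step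
`M (i + 1) / M i ≅ Δ(l)` of it, the element `δ(m) · d` lies in `M (i + 1)` and its class
corresponds to `δ(l)`. -/
def IsBranchingFactor (δ : ∀ r (l : T.Shape r), T.CellModule l) {r : ℕ} (l : T.Shape r)
    (m : T.Shape (r + 1)) (d : T.A (r + 1)) : Prop :=
  ∃ f : (T.cell r).CellFiltration (T.resAct m), f.OrderPreserving ∧
    ∃ i, f.shape i = l ∧
      ∃ h : (T.cell (r + 1)).act m d (δ (r + 1) m) ∈ f.M i.succ,
        f.iso i (Submodule.Quotient.mk ⟨_, h⟩) = δ r (f.shape i)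

section BaseChange

variable (F : Type*) [Field F] [Algebra R F]

/-- The algebra `A_r^F`. -/
abbrev AF (r : ℕ) : Type _ := F ⊗[R] T.A r

/-- The module `Δ_r^F(l)`. -/
abbrev CellModuleF {r : ℕ} (l : T.Shape r) : Type _ := F ⊗[R] T.CellModule l

/-- The inclusion of `A_r^F` in `A_{r+1}^F`. -/
def inclF (r : ℕ) : T.AF F r →ₐ[F] T.AF F (r + 1) :=
  Algebra.TensorProduct.map (AlgHom.id F F) (T.incl r)

/-- The involution of `A_r^F`. -/
def invF (r : ℕ) : T.AF F r →ₗ[F] T.AF F r := (T.cell r).inv.baseChange F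

/-- The minimal central idempotent `z_l` of `A_r^F` labelled by `l`: the one that acts as the
identity on `Δ_r^F(l)`. -/
def centralIdem {r : ℕ} (l : T.Shape r) : T.AF F r :=
  Classical.epsilon fun z : T.AF F r =>
    IsMinimalCentralIdempotent z ∧ (T.cell r).actBaseChange F l z = LinearMap.id

/-- The Gelfand-Zeitlin idempotent `F_t = z_{t(1)} ⋯ z_{t(r)}` of a path `t` of length `r`. -/
def gzIdem : ∀ {r : ℕ} {l : T.Shape r}, T.Path r l → T.AF F r
  | 0, _, _ => 1
  | _ + 1, m, .snoc t _ => T.inclF F _ (gzIdem t) * T.centralIdem F m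

end BaseChange

end CellularTower

/-! ### Sequences of diagram algebras -/

/-- A sequence of diagram algebras over `R`, with `F` in the role of the field of fractions of `R`,
together with the choices on which its Murphy bases depend: generators `δ` of the cell
modules, bimodule isomorphisms `α`, the elements `gen l` (written `m_l` in the text), and the
branching factors `d`. -/
structure DiagramSequence (R : Type uR) (F : Type uF) [CommRing R] [Field F] [Algebra R F] extends
    CellularTower.{uR, uA, uL, uS} R where
  /-- `A_0 = R`. -/
  zero_bijective : Function.Bijective (algebraMap R (A 0))
  /-- The algebras are cyclic cellular, with `δ r l` a generator of the cell module. -/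
  δ : ∀ r (l : (cell r).Shape), (cell r).CellModule l
  δ_generates : ∀ r (l : (cell r).Shape) (x : (cell r).CellModule l),
    ∃ a : A r, (cell r).act l a (δ r l) = x
  /-- The fixed bimodule isomorphisms. -/
  α : ∀ r (l : (cell r).Shape), (cell r).BimoduleIso l
  /-- The elements `m_l` of `A^{⊵ l}`, whose class corresponds to `δ(l)* ⊗ δ(l)`. -/
  gen : ∀ r (l : (cell r).Shape), (cell r).ge l
  α_gen : ∀ r (l : (cell r).Shape),
    (α r l).toEquiv (Submodule.Quotient.mk (gen r l)) = δ r l ⊗ₜ[R] δ r l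
  /-- `m_l* = m_l`. -/
  inv_gen : ∀ r (l : (cell r).Shape), (cell r).inv (gen r l) = gen r l
  splitSemisimple : ∀ r, IsSplitSemisimple F (F ⊗[R] A r)
  restrictionCoherent : toCellularTower.RestrictionCoherent
  /-- The branching factors. -/
  d : ∀ {r : ℕ} {l : (cell r).Shape} {m : (cell (r + 1)).Shape},
    toCellularTower.Edge l m → A (r + 1)
  isBranchingFactor : ∀ {r : ℕ} {l : (cell r).Shape} {m : (cell (r + 1)).Shape}
    (h : toCellularTower.Edge l m), toCellularTower.IsBranchingFactor δ l m (d h)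
  /-- There are `u`-branching factors with `m_m d_{l → m} = u_{l → m}* m_l`. -/
  compatibility : ∀ {r : ℕ} {l : (cell r).Shape} {m : (cell (r + 1)).Shape}
    (h : toCellularTower.Edge l m), ∃ u : A (r + 1),
      (gen (r + 1) m : A (r + 1)) * d h = (cell (r + 1)).inv u * incl r (gen r l)

namespace DiagramSequence

variable {R : Type uR} {F : Type uF} [CommRing R] [Field F] [Algebra R F]
  (T : DiagramSequence.{uR, uF, uA, uL, uS} R F)

/-- Standard tableaux of shape `l`. -/
abbrev Std {r : ℕ} (l : T.Shape r) : Type _ := T.Path r l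

/-- `d_t = d_{t(r-1) → t(r)} ⋯ d_{t(0) → t(1)}`. -/
def dPath : ∀ {r : ℕ} {l : T.Shape r}, T.Path r l → T.A r
  | 0, _, _ => 1
  | _ + 1, _, .snoc t h => T.d h * T.incl _ (dPath t)

/-- The Murphy basis element `m_{st} = d_s* m_l d_t` of `A_r`. -/
def murphy {r : ℕ} (l : T.Shape r) (s t : T.Std l) : T.A r :=
  (T.cell r).inv (T.dPath s) * T.gen r l * T.dPath t

/-- The Murphy basis element `m_t` of the cell module: the class of `m_l d_t` modulo `A^{▷ l}`
under the isomorphism `(m_l A + A^{▷ l}) / A^{▷ l} ≅ Δ(l)` that sends the class of `m_l a` to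
`δ(l) · a`. -/
def murphyCell {r : ℕ} (l : T.Shape r) (t : T.Std l) : T.CellModule l :=
  (T.cell r).act l (T.dPath t) (T.δ r l)

/-- The seminormal basis element `f_t = m_t F_t` of `Δ_r^F(l)`. -/
def seminormalCell {r : ℕ} (l : T.Shape r) (t : T.Std l) : T.CellModuleF F l :=
  (T.cell r).actBaseChange F l (T.gzIdem F t) (1 ⊗ₜ[R] T.murphyCell l t)

/-- The seminormal basis element `F_{st} = F_s m_{st} F_t` of `A_r^F`. -/
def seminormal {r : ℕ} (l : T.Shape r) (s t : T.Std l) : T.AF F r :=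
  T.gzIdem F s * (1 ⊗ₜ[R] T.murphy l s t) * T.gzIdem F t

end DiagramSequence

end Cellular

end

/-! Central idempotents. In the semisimple algebra `A_r^F` the ideals spanned by the shapes `⊵ l`
and `▷ l` are generated by central idempotents. Their difference is `z_l`: it acts as the identity
on `Δ(l)`, and distinct `z_l` are orthogonal (`isLayerIdem_centralIdem`). Hence `F_t` absorbs the
`z` of its end point, is killed by every other `z` of that level, and is fixed by `*`.

Independence of the `f_t`, by induction on `r`. For a path `t` to `l` extended by `l → m`, the last
factor `z_m` is the identity on `Δ(m)`, so `f` is `δ(m) d_{l → m}` acted on by `d_t F_t`. Acting by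
the idempotents of level `r` separates paths by their penultimate vertex `l`. For fixed `l`, an
element of `A_r^F` that kills `δ(m) d_{l → m}` also kills `δ(l)`, because the latter is the image of
the former in a filtration quotient (`act_eq_zero_of_edge`). A relation among the `f` thus descends
to one in `Δ^F(l)`.

Spanning is a count. Ranks add along an order preserving filtration, whose shapes are distinct end
points of edges into `m`, so the rank of `Δ(m)` is at most the number of paths to `m`
(`card_idx_le`); independence gives the reverse inequality.

The algebra. Since `F_st = (d_s F_s)* m_l (d_t F_t)`, the base change of the bimodule isomorphism
sends `F_st · a` to `f_s ⊗ (f_t · a)` (`extend_seminormal_mul`). With the `z_l` this gives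
independence, and `∑ |Std l|²` is the dimension. The same map is injective on `A^F z_l`, so the
multiplication rule is read off from `f_t · a`; it holds exactly, not only modulo higher shapes, and
so does `F_st* = F_ts`. -/

namespace Cellular

/-! ### Ideals and cell modules of a cellular algebra -/

namespace CellDatum

section General

variable {R : Type uR} {A : Type uA} [CommRing R] [Ring A] [Algebra R A]
  (D : CellDatum.{uR, uA, uL, uS} R A)

theorem basis_apply (p : Σ l, D.Idx l × D.Idx l) : D.basis p = D.c p.1 p.2.1 p.2.2 := by
  simp [basis]

theorem c_eq_basis (l : D.Shape) (s t : D.Idx l) : D.c l s t = D.basis ⟨l, (s, t)⟩ := by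
  simp [basis]

theorem c_mem_ge {l k : D.Shape} (h : l ≤ k) (s t : D.Idx k) : D.c k s t ∈ D.ge l :=
  Submodule.subset_span ⟨k, h, s, t, rfl⟩

theorem c_mem_gt {l k : D.Shape} (h : l < k) (s t : D.Idx k) : D.c k s t ∈ D.gt l :=
  Submodule.subset_span ⟨k, h, s, t, rfl⟩

theorem gt_le_ge (l : D.Shape) : D.gt l ≤ D.ge l :=
  Submodule.span_mono fun _ ⟨k, h, s, t, e⟩ => ⟨k, h.le, s, t, e⟩

theorem ge_le_gt {l k : D.Shape} (h : l < k) : D.ge k ≤ D.gt l :=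
  Submodule.span_mono fun _ ⟨j, hj, s, t, e⟩ => ⟨j, h.trans_le hj, s, t, e⟩

theorem ge_anti {l k : D.Shape} (h : l ≤ k) : D.ge k ≤ D.ge l :=
  Submodule.span_mono fun _ ⟨j, hj, s, t, e⟩ => ⟨j, h.trans hj, s, t, e⟩

theorem repr_c (l : D.Shape) (s t : D.Idx l) :
    D.basis.repr (D.c l s t) = Finsupp.single ⟨l, (s, t)⟩ 1 := by
  rw [c_eq_basis, Module.Basis.repr_self]

theorem mem_ge_iff {l : D.Shape} {x : A} :
    x ∈ D.ge l ↔ ∀ p : Σ l, D.Idx l × D.Idx l, ¬ l ≤ p.1 → D.basis.repr x p = 0 := by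
  classical
  constructor
  · intro hx p hp
    induction hx using Submodule.span_induction with
    | mem x hx =>
      obtain ⟨k, hk, u, w, rfl⟩ := hx
      rw [repr_c, Finsupp.single_apply, if_neg]
      rintro rfl
      exact hp hk
    | zero => simp
    | add x y _ _ hx hy => simp [hx, hy]
    | smul c x _ hx => simp [hx]
  · intro h
    rw [← D.basis.linearCombination_repr x, Finsupp.linearCombination_apply]
    refine Submodule.sum_mem _ fun p hp => Submodule.smul_mem _ _ ?_
    rw [basis_apply]
    refine D.c_mem_ge ?_ _ _
    by_contra hl
    exact (Finsupp.mem_support_iff.mp hp) (h p hl)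

theorem mem_gt_iff {l : D.Shape} {x : A} :
    x ∈ D.gt l ↔ ∀ p : Σ l, D.Idx l × D.Idx l, ¬ l < p.1 → D.basis.repr x p = 0 := by
  classical
  constructor
  · intro hx p hp
    induction hx using Submodule.span_induction with
    | mem x hx =>
      obtain ⟨k, hk, u, w, rfl⟩ := hx
      rw [repr_c, Finsupp.single_apply, if_neg]
      rintro rfl
      exact hp hk
    | zero => simp
    | add x y _ _ hx hy => simp [hx, hy]
    | smul c x _ hx => simp [hx]
  · intro h
    rw [← D.basis.linearCombination_repr x, Finsupp.linearCombination_apply]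
    refine Submodule.sum_mem _ fun p hp => Submodule.smul_mem _ _ ?_
    rw [basis_apply]
    refine D.c_mem_gt ?_ _ _
    by_contra hl
    exact (Finsupp.mem_support_iff.mp hp) (h p hl)

/-- The coefficients of `x` live on shapes above both `l` and `k`, and `l` itself is not above `k`.
-/
theorem mem_gt_of_mem_ge {l k : D.Shape} (hne : ¬ k ≤ l) {x : A} (hl : x ∈ D.ge l)
    (hk : x ∈ D.ge k) : x ∈ D.gt l := by
  rw [mem_gt_iff]
  intro p hp
  by_cases h : l ≤ p.1
  · by_cases h' : k ≤ p.1
    · rcases h.eq_or_lt with e | e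
      · exact absurd (e ▸ h') hne
      · exact absurd e hp
    · exact D.mem_ge_iff.mp hk p h'
  · exact D.mem_ge_iff.mp hl p h

/-- The copy of the cell module spanned by the row `c l s _` of the cellular basis. -/
noncomputable def row {l : D.Shape} (s : D.Idx l) : D.CellModule l →ₗ[R] A :=
  Finsupp.linearCombination R (D.c l s)

theorem row_single {l : D.Shape} (s t : D.Idx l) :
    D.row s (Finsupp.single t 1) = D.c l s t := by
  simp [row]

theorem row_mem_ge {l : D.Shape} (s : D.Idx l) (x : D.CellModule l) : D.row s x ∈ D.ge l := by
  rw [row, Finsupp.linearCombination_apply]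
  exact Submodule.sum_mem _ fun v _ => Submodule.smul_mem _ _ (D.c_mem_ge le_rfl _ _)

theorem repr_row {l : D.Shape} (s v : D.Idx l) (x : D.CellModule l) :
    D.basis.repr (D.row s x) ⟨l, (s, v)⟩ = x v := by
  classical
  induction x using Finsupp.induction_linear with
  | zero => simp
  | add x y hx hy => simp [hx, hy]
  | single t k =>
    have e : (Finsupp.single t k : D.CellModule l) = k • Finsupp.single t 1 := by simp
    rw [e, map_smul, row_single, map_smul, repr_c]
    by_cases h : t = v
    · subst h; simp
    · simp [h]

/-- A row embeds the cell module in `A` modulo `A^{▷ l}`. Together with `row_mul_sub_mem`, this lets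
identities in the cell module be checked inside `A`. -/
theorem eq_zero_of_row_mem_gt {l : D.Shape} (s : D.Idx l) {x : D.CellModule l}
    (h : D.row s x ∈ D.gt l) : x = 0 := by
  ext v
  rw [← D.repr_row s v x]
  exact D.mem_gt_iff.mp h _ (lt_irrefl l)

theorem row_mul_sub_mem {l : D.Shape} (s : D.Idx l) (x : D.CellModule l) (a : A) :
    D.row s x * a - D.row s (D.act l a x) ∈ D.gt l := by
  induction x using Finsupp.induction_linear with
  | zero => simp
  | add x y hx hy =>
    have := Submodule.add_mem _ hx hy
    rw [map_add, map_add, map_add, add_mul]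
    convert this using 1
    abel
  | single t k =>
    have e : (Finsupp.single t k : D.CellModule l) = k • Finsupp.single t 1 := by simp
    rw [e, map_smul, map_smul, map_smul, smul_mul_assoc, ← smul_sub, row_single, act_single]
    refine Submodule.smul_mem _ _ ?_
    simpa [row, Finsupp.linearCombination_apply] using D.actBasis_spec s t a

theorem c_mul_mem_ge {l k : D.Shape} (h : l ≤ k) (s t : D.Idx k) (a : A) :
    D.c k s t * a ∈ D.ge l := by
  have := D.row_mul_sub_mem s (Finsupp.single t 1) a
  rw [row_single] at this
  have h2 := Submodule.add_mem _ (D.gt_le_ge k this)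
    (D.row_mem_ge s (D.act k a (Finsupp.single t 1)))
  rw [sub_add_cancel] at h2
  exact D.ge_anti h h2

theorem ge_mul_mem {l : D.Shape} {x : A} (hx : x ∈ D.ge l) (a : A) : x * a ∈ D.ge l := by
  induction hx using Submodule.span_induction with
  | mem x hx =>
    obtain ⟨k, hk, u, w, rfl⟩ := hx
    exact D.c_mul_mem_ge hk u w a
  | zero => simp
  | add x y _ _ hx hy => rw [add_mul]; exact Submodule.add_mem _ hx hy
  | smul c x _ hx => rw [smul_mul_assoc]; exact Submodule.smul_mem _ _ hx

theorem gt_mul_mem {l : D.Shape} {x : A} (hx : x ∈ D.gt l) (a : A) : x * a ∈ D.gt l := by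
  induction hx using Submodule.span_induction with
  | mem x hx =>
    obtain ⟨k, hk, u, w, rfl⟩ := hx
    exact D.ge_le_gt hk (D.c_mul_mem_ge le_rfl u w a)
  | zero => simp
  | add x y _ _ hx hy => rw [add_mul]; exact Submodule.add_mem _ hx hy
  | smul c x _ hx => rw [smul_mul_assoc]; exact Submodule.smul_mem _ _ hx

theorem inv_c_mem_ge {l k : D.Shape} (h : l ≤ k) (s t : D.Idx k) : D.inv (D.c k s t) ∈ D.ge l := by
  have h2 := Submodule.add_mem _ (D.gt_le_ge k (D.isCellularBasis.inv_mem k s t))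
    (D.c_mem_ge le_rfl t s)
  rw [sub_add_cancel] at h2
  exact D.ge_anti h h2

theorem inv_mem_ge {l : D.Shape} {x : A} (hx : x ∈ D.ge l) : D.inv x ∈ D.ge l := by
  induction hx using Submodule.span_induction with
  | mem x hx =>
    obtain ⟨k, hk, u, w, rfl⟩ := hx
    exact D.inv_c_mem_ge hk u w
  | zero => simp
  | add x y _ _ hx hy => rw [map_add]; exact Submodule.add_mem _ hx hy
  | smul c x _ hx => rw [map_smul]; exact Submodule.smul_mem _ _ hx

theorem inv_mem_gt {l : D.Shape} {x : A} (hx : x ∈ D.gt l) : D.inv x ∈ D.gt l := by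
  induction hx using Submodule.span_induction with
  | mem x hx =>
    obtain ⟨k, hk, u, w, rfl⟩ := hx
    exact D.ge_le_gt hk (D.inv_c_mem_ge le_rfl u w)
  | zero => simp
  | add x y _ _ hx hy => rw [map_add]; exact Submodule.add_mem _ hx hy
  | smul c x _ hx => rw [map_smul]; exact Submodule.smul_mem _ _ hx

/-- The involution preserves the span and reverses products, so left stability follows from right
stability. -/
theorem mul_ge_mem {l : D.Shape} {x : A} (hx : x ∈ D.ge l) (a : A) : a * x ∈ D.ge l := by
  have h := D.inv_mem_ge (D.ge_mul_mem (D.inv_mem_ge hx) (D.inv a))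
  rwa [D.isCellularBasis.inv_mul, D.isCellularBasis.inv_inv, D.isCellularBasis.inv_inv] at h

theorem mul_gt_mem {l : D.Shape} {x : A} (hx : x ∈ D.gt l) (a : A) : a * x ∈ D.gt l := by
  have h := D.inv_mem_gt (D.gt_mul_mem (D.inv_mem_gt hx) (D.inv a))
  rwa [D.isCellularBasis.inv_mul, D.isCellularBasis.inv_inv, D.isCellularBasis.inv_inv] at h

theorem inv_one : D.inv 1 = 1 := by
  have h := D.isCellularBasis.inv_mul (D.inv 1) 1
  rw [D.isCellularBasis.inv_inv] at h
  simpa [D.isCellularBasis.inv_inv] using h.symm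

theorem act_one (l : D.Shape) : D.act l 1 = LinearMap.id := by
  refine Finsupp.lhom_ext' fun t => LinearMap.ext_ring ?_
  have h := D.row_mul_sub_mem t (Finsupp.single t 1) 1
  rw [mul_one, ← map_sub] at h
  exact (sub_eq_zero.mp (D.eq_zero_of_row_mem_gt t h)).symm

theorem act_mul (l : D.Shape) (a b : A) : D.act l (a * b) = D.act l b ∘ₗ D.act l a := by
  refine Finsupp.lhom_ext' fun t => LinearMap.ext_ring ?_
  set x : D.CellModule l := Finsupp.single t 1
  have h1 := D.row_mul_sub_mem t x (a * b)
  have h2 := D.gt_mul_mem (D.row_mul_sub_mem t x a) b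
  have h3 := D.row_mul_sub_mem t (D.act l a x) b
  have h4 := Submodule.sub_mem _ (Submodule.add_mem _ h2 h3) h1
  refine sub_eq_zero.mp (D.eq_zero_of_row_mem_gt t ?_)
  rw [map_sub]
  convert h4 using 1
  simp only [LinearMap.comp_apply, Finsupp.lsingle_apply, x, sub_mul, mul_assoc]
  abel

theorem act_mul_apply (l : D.Shape) (a b : A) (x : D.CellModule l) :
    D.act l (a * b) x = D.act l b (D.act l a x) := by
  rw [act_mul]; rfl

instance (l : D.Shape) : Finite (D.Idx l) := D.isCellularBasis.finite_index l

instance : Finite D.Shape := D.isCellularBasis.finite_poset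

end General

end CellDatum

/-! ### Central idempotents in semisimple rings -/

theorem exists_central_idempotent_of_two_sided {K A : Type*} [Field K] [Ring A] [Algebra K A]
    [IsSemisimpleRing A] (inv : A →ₗ[K] A) (inv_mul : ∀ a b, inv (a * b) = inv b * inv a)
    (inv_inv : ∀ a, inv (inv a) = a) (I : Submodule K A) (hl : ∀ x ∈ I, ∀ a, a * x ∈ I)
    (hi : ∀ x ∈ I, inv x ∈ I) :
    ∃ e ∈ I, (∀ x ∈ I, e * x = x) ∧ (∀ x ∈ I, x * e = x) ∧ (∀ a, a * e = e * a) ∧ inv e = e := by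
  let J : Ideal A :=
    { carrier := I
      add_mem' := fun ha hb => I.add_mem ha hb
      zero_mem' := I.zero_mem
      smul_mem' := fun a x hx => hl x hx a }
  have memJ : ∀ x, x ∈ J ↔ x ∈ I := fun _ => Iff.rfl
  -- A left ideal of a semisimple ring is `Ae`, so `e` is a right unit of `I` and `inv e` a left
  -- unit; the two must coincide. Then `ae` and `ea` both equal `eae`.
  obtain ⟨e, he, hJ⟩ := IsSemisimpleRing.ideal_eq_span_idempotent J
  have heI : e ∈ I := (memJ e).mp (hJ ▸ Ideal.mem_span_singleton_self e)
  have h1 : ∀ x ∈ I, x * e = x := by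
    intro x hx
    have : x ∈ Ideal.span {e} := hJ ▸ (memJ x).mpr hx
    obtain ⟨a, rfl⟩ := Ideal.mem_span_singleton'.mp this
    rw [mul_assoc, he.eq]
  have h2 : ∀ x ∈ I, inv e * x = x := by
    intro x hx
    have := congrArg inv (h1 _ (hi x hx))
    rwa [inv_mul, inv_inv] at this
  have h3 : inv e = e := by
    rw [← h1 _ (hi e heI), h2 e heI]
  rw [h3] at h2
  have hr : ∀ x ∈ I, ∀ a, x * a ∈ I := by
    intro x hx a
    have := hi _ (hl _ (hi x hx) (inv a))
    rwa [inv_mul, inv_inv, inv_inv] at this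
  refine ⟨e, heI, h2, h1, fun a => ?_, h3⟩
  rw [← h2 _ (hl e heI a), ← mul_assoc, h1 _ (hr e heI a)]

theorem IsMinimalCentralIdempotent.comm {A : Type*} [Ring A] {e : A}
    (h : IsMinimalCentralIdempotent e) (a : A) : a * e = e * a :=
  Subring.mem_center_iff.mp h.1 a

/-- The product is a nonzero central idempotent below both, so minimality identifies it with each.
-/
theorem IsMinimalCentralIdempotent.eq_of_mul_ne_zero {A : Type*} [Ring A]
    {e f : A} (he : IsMinimalCentralIdempotent e) (hf : IsMinimalCentralIdempotent f)
    (h : e * f ≠ 0) : e = f := by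
  have hc := Subring.mul_mem _ he.1 hf.1
  have h1 : e * f * e = e * f := by rw [he.comm, ← mul_assoc, he.2.1]
  have h2 : e * f * f = e * f := by rw [mul_assoc, hf.2.1]
  have hi : e * f * (e * f) = e * f := by rw [← mul_assoc, h1, h2]
  exact ((he.2.2.2 _ hc hi h1).resolve_left h).symm.trans
    ((hf.2.2.2 _ hc hi h2).resolve_left h)

/-! ### The idempotent of a layer over a field -/

namespace CellDatum

variable {K : Type uR} {A : Type uA} [Field K] [Ring A] [Algebra K A]
  (D : CellDatum.{uR, uA, uL, uS} K A)

/-- The element `z` is a central idempotent that splits off the layer `A^{⊵ l} / A^{▷ l}`. -/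
structure IsLayerIdem (l : D.Shape) (z : A) : Prop where
  mem_ge : z ∈ D.ge l
  comm : ∀ a, a * z = z * a
  idem : z * z = z
  mul_gt : ∀ x ∈ D.gt l, z * x = 0
  sub_mem : ∀ x ∈ D.ge l, x - z * x ∈ D.gt l
  inv_eq : D.inv z = z

theorem exists_isLayerIdem [IsSemisimpleRing A] (l : D.Shape) : ∃ z, D.IsLayerIdem l z := by
  have him := D.isCellularBasis.inv_mul
  have hii := D.isCellularBasis.inv_inv
  obtain ⟨e, he, he1, he2, hec, hei⟩ := exists_central_idempotent_of_two_sided D.inv him hii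
    (D.ge l) (fun x hx a => D.mul_ge_mem hx a) (fun x hx => D.inv_mem_ge hx)
  obtain ⟨f, hf, hf1, hf2, hfc, hfi⟩ := exists_central_idempotent_of_two_sided D.inv him hii
    (D.gt l) (fun x hx a => D.mul_gt_mem hx a) (fun x hx => D.inv_mem_gt hx)
  have hfe := D.gt_le_ge l hf
  -- The unit of `A^{⊵ l}` minus the unit of its subideal `A^{▷ l}`.
  refine ⟨e - f, Submodule.sub_mem _ he hfe, fun a => ?_, ?_, fun x hx => ?_, fun x hx => ?_, ?_⟩
  · rw [mul_sub, sub_mul, hec, hfc]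
  · rw [mul_sub, sub_mul, sub_mul, he1 e he, he2 f hfe, he1 f hfe, hf1 f hf]
    abel
  · rw [sub_mul, he1 x (D.gt_le_ge l hx), hf1 x hx, sub_self]
  · rw [sub_mul, he1 x hx, sub_sub_cancel]
    exact D.gt_mul_mem hf x
  · rw [map_sub, hei, hfi]

variable {D}

namespace IsLayerIdem

variable {l : D.Shape} {z : A} (hz : D.IsLayerIdem l z)

include hz

theorem act_eq : D.act l z = LinearMap.id := by
  refine Finsupp.lhom_ext' fun t => LinearMap.ext_ring ?_
  have h := D.row_mul_sub_mem t (Finsupp.single t 1) z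
  have h2 := Submodule.add_mem _ h
    (hz.sub_mem _ (D.row_mem_ge t (Finsupp.single t 1)))
  rw [hz.comm] at h2
  refine (sub_eq_zero.mp (D.eq_zero_of_row_mem_gt t ?_)).symm
  rw [map_sub]
  convert h2 using 1
  simp only [LinearMap.comp_apply, Finsupp.lsingle_apply, LinearMap.id_apply]
  abel

/-- The product lies in both `A^{⊵ l}` and `A^{⊵ k}`. By antisymmetry one of the shapes is not below
the other, so the product falls into a `▷` ideal, which one of the idempotents annihilates. -/
theorem mul_eq_zero {k : D.Shape} {w : A} (hw : D.IsLayerIdem k w) (hne : l ≠ k) : z * w = 0 := by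
  wlog h : ¬ k ≤ l generalizing l k z w
  · rw [← hz.comm]
    exact this hw hz hne.symm fun h' => hne (le_antisymm h' (not_not.mp h))
  have h1 : z * w ∈ D.gt l :=
    D.mem_gt_of_mem_ge h (D.ge_mul_mem hz.mem_ge w) (D.mul_ge_mem hw.mem_ge z)
  rw [← hz.idem, mul_assoc, hz.mul_gt _ h1]

/-- Right multiplication by such an `a` pushes `A^{⊵ l}` into `A^{▷ l}`, which `z` annihilates: the
layer `zA` acts faithfully on `Δ(l)`. -/
theorem eq_zero_of_act_eq_zero {a : A} (ha : D.act l a = 0) : z * a = 0 := by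
  have key : ∀ x ∈ D.ge l, x * a ∈ D.gt l := by
    intro x hx
    induction hx using Submodule.span_induction with
    | mem x hx =>
      obtain ⟨k, hk, u, w, rfl⟩ := hx
      rcases hk.eq_or_lt with rfl | hk
      · have h := D.row_mul_sub_mem u (Finsupp.single w 1) a
        rwa [ha, row_single, LinearMap.zero_apply, map_zero, sub_zero] at h
      · exact D.ge_le_gt hk (D.c_mul_mem_ge le_rfl u w a)
    | zero => simp
    | add x y _ _ hx hy => rw [add_mul]; exact Submodule.add_mem _ hx hy
    | smul c x _ hx => rw [smul_mul_assoc]; exact Submodule.smul_mem _ _ hx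
  rw [← hz.idem, mul_assoc, hz.mul_gt _ (key z hz.mem_ge)]

/-- Multiplying an element of `A^{⊵ l}` by `z` changes it only within `A^{▷ l}`, so the coefficients
of shape `l` survive. -/
theorem linearIndependent :
    LinearIndependent K fun p : D.Idx l × D.Idx l => z * D.c l p.1 p.2 := by
  have : Fintype (D.Idx l) := Fintype.ofFinite _
  rw [Fintype.linearIndependent_iff]
  intro g hg p
  set y := ∑ q : D.Idx l × D.Idx l, g q • D.c l q.1 q.2 with hy
  have hyge : y ∈ D.ge l :=
    Submodule.sum_mem _ fun q _ => Submodule.smul_mem _ _ (D.c_mem_ge le_rfl _ _)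
  have hzy : z * y = 0 := by
    rw [hy, Finset.mul_sum, ← hg]
    exact Finset.sum_congr rfl fun q _ => mul_smul_comm _ _ _
  have h1 := hz.sub_mem y hyge
  rw [hzy, sub_zero, mem_gt_iff] at h1
  have h2 := h1 ⟨l, p⟩ (lt_irrefl l)
  classical
  rw [hy, map_sum, Finsupp.finsetSum_apply, Finset.sum_eq_single p] at h2
  · simpa [repr_c] using h2
  · intro q _ hq
    rw [map_smul, repr_c, Finsupp.smul_apply, Finsupp.single_apply, if_neg, smul_zero]
    simpa using hq
  · simp

/-- A dimension count: `zA` embeds in `End Δ(l)` and already contains `|Idx l|²` independent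
elements. -/
theorem exists_act_eq (f : Module.End K (D.CellModule l)) : ∃ a, D.act l (z * a) = f := by
  have : Fintype (D.Idx l) := Fintype.ofFinite _
  have : Finite (Σ l, D.Idx l × D.Idx l) := inferInstance
  have : Module.Finite K A := Module.Finite.of_basis D.basis
  let W : Submodule K A := LinearMap.range (LinearMap.mulLeft K z)
  let ψ : W →ₗ[K] Module.End K (D.CellModule l) := D.act l ∘ₗ W.subtype
  have hinj : Function.Injective ψ := by
    refine (injective_iff_map_eq_zero ψ).mpr ?_
    rintro ⟨_, a, rfl⟩ h
    have h' : D.act l (z * a) = 0 := h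
    have h2 := hz.eq_zero_of_act_eq_zero h'
    rw [← mul_assoc, hz.idem] at h2
    exact Subtype.ext h2
  have hW : Fintype.card (D.Idx l) * Fintype.card (D.Idx l) ≤ Module.finrank K W := by
    have hli : LinearIndependent K fun p : D.Idx l × D.Idx l =>
        (⟨z * D.c l p.1 p.2, D.c l p.1 p.2, rfl⟩ : W) :=
      LinearIndependent.of_comp W.subtype hz.linearIndependent
    simpa using hli.fintype_card_le_finrank
  have hdim : Module.finrank K W = Module.finrank K (Module.End K (D.CellModule l)) := by
    refine le_antisymm (LinearMap.finrank_le_finrank_of_injective hinj) ?_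
    rw [Module.finrank_linearMap]
    simpa using hW
  obtain ⟨⟨_, a, rfl⟩, h⟩ :=
    (LinearMap.injective_iff_surjective_of_finrank_eq_finrank hdim).mp hinj f
  exact ⟨a, h⟩

/-- A central idempotent below `z` commutes with all of `End Δ(l)`, hence acts as an idempotent
scalar, `0` or `1`; faithfulness of the layer makes it `0` or `z`. -/
theorem isMinimalCentralIdempotent [Nonempty (D.Idx l)] : IsMinimalCentralIdempotent z := by
  refine ⟨Subring.mem_center_iff.mpr hz.comm, hz.idem, ?_, fun e hec hee hez => ?_⟩
  · rintro rfl
    have h := hz.act_eq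
    rw [map_zero] at h
    have h2 := LinearMap.congr_fun h (Finsupp.single (Classical.arbitrary (D.Idx l)) 1)
    exact Finsupp.single_ne_zero.mpr one_ne_zero h2.symm
  · have hc := Subring.mem_center_iff.mp hec
    have hcen : D.act l e ∈ Subalgebra.center K (Module.End K (D.CellModule l)) := by
      rw [Subalgebra.mem_center_iff]
      intro f
      obtain ⟨a, rfl⟩ := hz.exists_act_eq f
      rw [Module.End.mul_eq_comp, Module.End.mul_eq_comp, ← D.act_mul, ← D.act_mul, hc]
    rw [Algebra.IsCentral.center_eq_bot, Algebra.mem_bot] at hcen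
    obtain ⟨k, hk⟩ := hcen
    have hz1 : z * e = e := by rw [hc, hez]
    have hsq : k * k = k := by
      have h := D.act_mul l e e
      rw [hee, ← hk, ← Module.End.mul_eq_comp, ← map_mul] at h
      exact (FaithfulSMul.algebraMap_injective K (Module.End K (D.CellModule l)) h).symm
    rcases IsIdempotentElem.iff_eq_zero_or_one.mp hsq with rfl | rfl
    · left
      rw [map_zero] at hk
      rw [← hz1]
      exact hz.eq_zero_of_act_eq_zero hk.symm
    · right
      have h : D.act l (e - z) = 0 := by
        rw [map_sub, ← hk, hz.act_eq, map_one]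
        exact sub_self _
      have h2 := hz.eq_zero_of_act_eq_zero h
      rwa [mul_sub, hz1, hz.idem, sub_eq_zero] at h2

theorem eq_of_act_eq [Nonempty (D.Idx l)] {w : A} (hw : IsMinimalCentralIdempotent w)
    (h : D.act l w = LinearMap.id) : w = z := by
  refine hw.eq_of_mul_ne_zero hz.isMinimalCentralIdempotent fun h0 => ?_
  have h1 := D.act_mul l w z
  rw [h0, h, hz.act_eq, map_zero] at h1
  have h2 := LinearMap.congr_fun h1 (Finsupp.single (Classical.arbitrary (D.Idx l)) 1)
  exact Finsupp.single_ne_zero.mpr one_ne_zero h2.symm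

end IsLayerIdem

end CellDatum

/-! ### Extension of scalars to the field -/

namespace CellDatum

variable {R : Type uR} {A : Type uA} [CommRing R] [Ring A] [Algebra R A]
  (D : CellDatum.{uR, uA, uL, uS} R A) (F : Type uF) [Field F] [Algebra R F]

theorem one_tmul_mem_spanGT {l : D.Shape} {x : A} (hx : x ∈ D.gt l) :
    (1 : F) ⊗ₜ[R] x ∈ spanGT F (fun l s t => (1 : F) ⊗ₜ[R] D.c l s t) l := by
  induction hx using Submodule.span_induction with
  | mem x hx =>
    obtain ⟨k, hk, u, w, rfl⟩ := hx
    exact Submodule.subset_span ⟨k, hk, u, w, rfl⟩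
  | zero => simp
  | add x y _ _ hx hy => rw [TensorProduct.tmul_add]; exact Submodule.add_mem _ hx hy
  | smul c x _ hx =>
    have e : (1 : F) ⊗ₜ[R] (c • x) = algebraMap R F c • ((1 : F) ⊗ₜ[R] x) := by
      simp
    rw [e]
    exact Submodule.smul_mem _ _ hx

open scoped Classical in
theorem isCellularBasis_baseChange :
    IsCellularBasis (D.inv.baseChange F) (fun l (s t : D.Idx l) => (1 : F) ⊗ₜ[R] D.c l s t) := by
  have hb : (fun p : (Σ l, D.Idx l × D.Idx l) => (1 : F) ⊗ₜ[R] D.c p.1 p.2.1 p.2.2) =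
      Algebra.TensorProduct.basis F D.basis := by
    funext p
    rw [Algebra.TensorProduct.basis_apply, basis_apply]
  refine ⟨fun a b => ?_, fun a => ?_, D.isCellularBasis.finite_poset,
    D.isCellularBasis.finite_index, ?_, ?_, fun l t a => ?_, fun l s t => ?_⟩
  · induction a using TensorProduct.induction_on with
    | zero => simp
    | add x y hx hy => rw [add_mul, map_add, map_add, mul_add, hx, hy]
    | tmul x a =>
      induction b using TensorProduct.induction_on with
      | zero => simp
      | add x y hx hy => rw [mul_add, map_add, map_add, add_mul, hx, hy]
      | tmul y b => simp [D.isCellularBasis.inv_mul, mul_comm]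
  · induction a using TensorProduct.induction_on with
    | zero => simp
    | add x y hx hy => rw [map_add, map_add, hx, hy]
    | tmul x a => simp [D.isCellularBasis.inv_inv]
  · rw [hb]
    exact (Algebra.TensorProduct.basis F D.basis).linearIndependent
  · rw [hb]
    exact (Algebra.TensorProduct.basis F D.basis).span_eq
  · suffices h : ∃ r : D.Idx l →₀ F, ∀ s : D.Idx l, (1 : F) ⊗ₜ[R] D.c l s t * a -
        Finsupp.linearCombination F (fun v => (1 : F) ⊗ₜ[R] D.c l s v) r ∈
        spanGT F (fun l s t => (1 : F) ⊗ₜ[R] D.c l s t) l from h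
    induction a using TensorProduct.induction_on with
    | zero => exact ⟨0, fun s => by simp⟩
    | add x y hx hy =>
      obtain ⟨r, hr⟩ := hx
      obtain ⟨q, hq⟩ := hy
      refine ⟨r + q, fun s => ?_⟩
      have := Submodule.add_mem _ (hr s) (hq s)
      rw [mul_add, map_add]
      convert this using 1
      abel
    | tmul x a =>
      -- The coefficients over `R`, mapped to `F` and scaled by `x`.
      refine ⟨x • TensorProduct.finsuppScalarRight R F F _ (1 ⊗ₜ D.actBasis t a), fun s => ?_⟩
      have h := Submodule.smul_mem _ x (D.one_tmul_mem_spanGT F (D.actBasis_spec s t a))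
      have hrow : ∀ y : D.Idx l →₀ R,
          Finsupp.linearCombination F (fun v => (1 : F) ⊗ₜ[R] D.c l s v)
            (TensorProduct.finsuppScalarRight R F F _ (1 ⊗ₜ y)) =
          1 ⊗ₜ (y.sum fun v k => k • D.c l s v) := by
        intro y
        induction y using Finsupp.induction_linear with
        | zero => simp
        | add x y hx hy =>
          rw [TensorProduct.tmul_add, map_add, map_add, hx, hy, ← TensorProduct.tmul_add,
            Finsupp.sum_add_index' (by simp) (by simp [add_smul])]
        | single v k => simp [TensorProduct.finsuppScalarRight_apply_tmul]
      rw [map_smul, hrow]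
      convert h using 1
      rw [TensorProduct.tmul_sub, smul_sub]
      simp [TensorProduct.smul_tmul']
  · have h := D.one_tmul_mem_spanGT F (D.isCellularBasis.inv_mem l s t)
    rw [TensorProduct.tmul_sub] at h
    simpa using h

/-- The cell datum of `A^F = F ⊗ A`. -/
noncomputable abbrev baseChange : CellDatum.{uF, max uF uA, uL, uS} F (F ⊗[R] A) where
  inv := D.inv.baseChange F
  Shape := D.Shape
  Idx := D.Idx
  c := fun l s t => 1 ⊗ₜ[R] D.c l s t
  isCellularBasis := D.isCellularBasis_baseChange F

open scoped Classical in
/-- The cell module of the base change is the base change of the cell module. -/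
noncomputable def cellModuleEquiv (l : D.Shape) :
    F ⊗[R] D.CellModule l ≃ₗ[F] (D.baseChange F).CellModule l :=
  TensorProduct.finsuppScalarRight R F F (D.Idx l)

theorem actBaseChange_tmul (l : D.Shape) (x y : F) (a : A) (v : D.CellModule l) :
    D.actBaseChange F l (x ⊗ₜ a) (y ⊗ₜ v) = (x * y) ⊗ₜ D.act l a v := by
  simp [actBaseChange, TensorProduct.smul_tmul']

theorem row_cellModuleEquiv_tmul {l : D.Shape} (s : D.Idx l) (x : F) (v : D.CellModule l) :
    (D.baseChange F).row s (D.cellModuleEquiv F l (x ⊗ₜ v)) = x ⊗ₜ D.row s v := by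
  induction v using Finsupp.induction_linear with
  | zero => simp
  | add v w hv hw => simp only [TensorProduct.tmul_add, map_add, hv, hw]
  | single v k =>
    simp [cellModuleEquiv, TensorProduct.finsuppScalarRight_apply_tmul, row,
      TensorProduct.smul_tmul']

theorem cellModuleEquiv_act {l : D.Shape} (a : F ⊗[R] A) (x : F ⊗[R] D.CellModule l) :
    D.cellModuleEquiv F l (D.actBaseChange F l a x) =
      (D.baseChange F).act l a (D.cellModuleEquiv F l x) := by
  induction a using TensorProduct.induction_on with
  | zero => simp
  | add a b ha hb => simp only [map_add, LinearMap.add_apply, ha, hb]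
  | tmul k a =>
    induction x using TensorProduct.induction_on with
    | zero => simp
    | add x y hx hy => simp only [map_add, hx, hy]
    | tmul j v =>
      rw [actBaseChange_tmul]
      refine sub_eq_zero.mp ?_
      -- A row is needed to compare the actions inside the algebra; without any index the module is
      -- zero.
      by_cases hne : Nonempty (D.Idx l)
      · obtain ⟨s⟩ := hne
        refine (D.baseChange F).eq_zero_of_row_mem_gt s ?_
        have h1 := (D.baseChange F).row_mul_sub_mem s (D.cellModuleEquiv F l (j ⊗ₜ v)) (k ⊗ₜ[R] a)
        have h2 := Submodule.smul_mem _ (k * j)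
          (D.one_tmul_mem_spanGT F (D.row_mul_sub_mem s v a))
        have h3 := Submodule.sub_mem _ h1 h2
        rw [map_sub, row_cellModuleEquiv_tmul]
        rw [row_cellModuleEquiv_tmul] at h3
        convert h3 using 1
        rw [TensorProduct.tmul_sub, smul_sub, TensorProduct.smul_tmul', TensorProduct.smul_tmul',
          Algebra.TensorProduct.tmul_mul_tmul, smul_eq_mul, mul_one, mul_comm j k]
        abel
      · have : IsEmpty (D.Idx l) := not_nonempty_iff.mp hne
        have : Subsingleton ((D.baseChange F).CellModule l) :=
          inferInstanceAs (Subsingleton (D.Idx l →₀ F))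
        exact Subsingleton.elim _ _

theorem actBaseChange_one (l : D.Shape) : D.actBaseChange F l 1 = LinearMap.id := by
  ext x
  simp [Algebra.TensorProduct.one_def, actBaseChange_tmul, act_one]

theorem actBaseChange_mul (l : D.Shape) (a b : F ⊗[R] A) (x : F ⊗[R] D.CellModule l) :
    D.actBaseChange F l (a * b) x = D.actBaseChange F l b (D.actBaseChange F l a x) := by
  apply (D.cellModuleEquiv F l).injective
  rw [cellModuleEquiv_act, cellModuleEquiv_act, cellModuleEquiv_act, act_mul_apply]

theorem actBaseChange_eq_id_iff (l : D.Shape) (a : F ⊗[R] A) :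
    D.actBaseChange F l a = LinearMap.id ↔ (D.baseChange F).act l a = LinearMap.id := by
  constructor
  · intro h
    refine LinearMap.ext fun x => ?_
    obtain ⟨y, rfl⟩ := (D.cellModuleEquiv F l).surjective x
    rw [← cellModuleEquiv_act, h]
    rfl
  · intro h
    refine LinearMap.ext fun x => (D.cellModuleEquiv F l).injective ?_
    rw [cellModuleEquiv_act, h]
    rfl

end CellDatum

/-! ### Linear algebra and clearing of denominators -/

theorem IsSplitSemisimple.isSemisimpleRing {F A : Type*} [Field F] [Ring A] [Algebra F A]
    (h : IsSplitSemisimple F A) : IsSemisimpleRing A := by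
  obtain ⟨n, d, _, ⟨e⟩⟩ := h
  exact e.toRingEquiv.symm.isSemisimpleRing

/-- Block diagonality: `p i` kills every block but the `i`-th, so a relation splits into relations
within blocks. -/
theorem linearIndependent_sigma_of_proj {K V ι : Type*} {κ : ι → Type*} {W : ι → Type*} [Field K]
    [AddCommGroup V] [Module K V] [∀ i, AddCommGroup (W i)] [∀ i, Module K (W i)]
    (v : (Σ i, κ i) → V) (p : ∀ i, V →ₗ[K] W i)
    (h1 : ∀ i, LinearIndependent K fun s => p i (v ⟨i, s⟩))
    (h2 : ∀ i j, i ≠ j → ∀ s, p i (v ⟨j, s⟩) = 0) : LinearIndependent K v := by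
  classical
  rw [linearIndependent_iff]
  intro g hg
  ext ⟨i, s⟩
  have hinj : Function.Injective (Sigma.mk i : κ i → Σ i, κ i) := sigma_mk_injective
  have key : ∀ g : (Σ i, κ i) →₀ K, p i (Finsupp.linearCombination K v g) =
      Finsupp.linearCombination K (fun s => p i (v ⟨i, s⟩))
        (Finsupp.comapDomain (Sigma.mk i) g hinj.injOn) := by
    intro g
    induction g using Finsupp.induction_linear with
    | zero => simp
    | add x y hx hy =>
      rw [map_add, map_add, hx, hy, ← map_add, Finsupp.comapDomain_add_of_injective hinj]
    | single a c =>
      obtain ⟨j, t⟩ := a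
      by_cases hij : i = j
      · subst hij
        simp
      · have h0 : Finsupp.comapDomain (Sigma.mk i)
            (Finsupp.single (⟨j, t⟩ : Σ i, κ i) c) hinj.injOn = 0 := by
          ext u
          rw [Finsupp.comapDomain_apply, Finsupp.single_apply, if_neg]
          · rfl
          · intro h
            exact hij (congrArg Sigma.fst h).symm
        simp [h0, h2 i j hij t]
  have h := key g
  rw [hg, map_zero] at h
  have h3 := linearIndependent_iff.mp (h1 i) _ h.symm
  exact DFunLike.congr_fun h3 s

theorem linearIndependent_map_of_ker_le {K U V W ι : Type*} [Field K] [AddCommGroup U] [Module K U]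
    [AddCommGroup V] [Module K V] [AddCommGroup W] [Module K W] (Φ : U →ₗ[K] V) (Ψ : U →ₗ[K] W)
    (h : ∀ u, Φ u = 0 → Ψ u = 0) (a : ι → U) (hΨ : LinearIndependent K fun i => Ψ (a i)) :
    LinearIndependent K fun i => Φ (a i) := by
  rw [linearIndependent_iff] at hΨ ⊢
  intro g hg
  refine hΨ g ?_
  have e1 := (Finsupp.apply_linearCombination K Ψ a g).symm
  have e2 := (Finsupp.apply_linearCombination K Φ a g).symm
  refine e1.trans (h _ (e2.symm.trans hg))

/-- Filtrations and branching factors live over `R`; this common denominator brings elements of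
`A^F` back there. -/
theorem exists_smul_eq_one_tmul {R F M : Type*} [CommRing R] [Field F] [Algebra R F]
    [IsDomain R] [IsFractionRing R F] [AddCommGroup M] [Module R M] (x : F ⊗[R] M) :
    ∃ c : R, c ≠ 0 ∧ ∃ y : M, algebraMap R F c • x = 1 ⊗ₜ y := by
  induction x using TensorProduct.induction_on with
  | zero => exact ⟨1, one_ne_zero, 0, by simp⟩
  | tmul k m =>
    obtain ⟨a, b, hb, rfl⟩ := IsFractionRing.div_surjective (A := R) k
    have hb0 : b ≠ 0 := nonZeroDivisors.ne_zero hb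
    have hb1 : algebraMap R F b ≠ 0 := by simpa using hb0
    refine ⟨b, hb0, a • m, ?_⟩
    rw [TensorProduct.smul_tmul', smul_eq_mul, mul_div_cancel₀ _ hb1, ← TensorProduct.smul_tmul,
      Algebra.smul_def, mul_one]
  | add x y hx hy =>
    obtain ⟨c, hc, m, hm⟩ := hx
    obtain ⟨d, hd, n, hn⟩ := hy
    refine ⟨c * d, mul_ne_zero hc hd, d • m + c • n, ?_⟩
    rw [smul_add, TensorProduct.tmul_add, map_mul]
    congr 1
    · rw [mul_comm, mul_smul, hm, TensorProduct.tmul_smul, algebraMap_smul]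
    · rw [mul_smul, hn, TensorProduct.tmul_smul, algebraMap_smul]

theorem one_tmul_finsupp_injective {R F ι : Type*} [CommRing R] [Field F] [Algebra R F]
    [IsDomain R] [IsFractionRing R F] {v : ι →₀ R} (h : (1 : F) ⊗ₜ[R] v = 0) : v = 0 := by
  classical
  ext i
  have h2 := DFunLike.congr_fun (congrArg (TensorProduct.finsuppScalarRight R F F ι) h) i
  rw [TensorProduct.finsuppScalarRight_apply_tmul_apply, map_zero, Finsupp.zero_apply,
    Algebra.smul_def, mul_one] at h2
  simpa using h2

/-! ### Gelfand-Zeitlin idempotents and descent along an edge -/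

namespace DiagramSequence

variable {R : Type uR} {F : Type uF} [CommRing R] [Field F] [Algebra R F]
  (T : DiagramSequence.{uR, uF, uA, uL, uS} R F)

/-- `centralIdem` is a choice by `Classical.epsilon`. The layer idempotent shows that a candidate
exists, and `eq_of_act_eq` that it is the only one. -/
theorem isLayerIdem_centralIdem {r : ℕ} (l : T.Shape r) :
    ((T.cell r).baseChange F).IsLayerIdem l (T.centralIdem F l) := by
  have : IsSemisimpleRing (F ⊗[R] T.A r) := (T.splitSemisimple r).isSemisimpleRing
  obtain ⟨z, hz⟩ := ((T.cell r).baseChange F).exists_isLayerIdem l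
  have : Nonempty (((T.cell r).baseChange F).Idx l) := T.nonempty_idx r l
  have hspec : IsMinimalCentralIdempotent (T.centralIdem F l) ∧
      (T.cell r).actBaseChange F l (T.centralIdem F l) = LinearMap.id :=
    Classical.epsilon_spec (p := fun z : T.AF F r =>
      IsMinimalCentralIdempotent z ∧ (T.cell r).actBaseChange F l z = LinearMap.id)
      ⟨z, hz.isMinimalCentralIdempotent,
        ((T.cell r).actBaseChange_eq_id_iff F l z).mpr hz.act_eq⟩
  have he : T.centralIdem F l = z :=
    hz.eq_of_act_eq hspec.1 (((T.cell r).actBaseChange_eq_id_iff F l _).mp hspec.2)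
  rw [he]
  exact hz

theorem centralIdem_comm {r : ℕ} (l : T.Shape r) (a : T.AF F r) :
    a * T.centralIdem F l = T.centralIdem F l * a :=
  (T.isLayerIdem_centralIdem l).comm a

theorem centralIdem_idem {r : ℕ} (l : T.Shape r) :
    T.centralIdem F l * T.centralIdem F l = T.centralIdem F l :=
  (T.isLayerIdem_centralIdem l).idem

theorem centralIdem_mul_eq_zero {r : ℕ} {l k : T.Shape r} (h : l ≠ k) :
    T.centralIdem F l * T.centralIdem F k = 0 :=
  (T.isLayerIdem_centralIdem l).mul_eq_zero (T.isLayerIdem_centralIdem k) h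

theorem invF_centralIdem {r : ℕ} (l : T.Shape r) :
    T.invF F r (T.centralIdem F l) = T.centralIdem F l :=
  (T.isLayerIdem_centralIdem l).inv_eq

theorem act_centralIdem {r : ℕ} (l : T.Shape r) :
    (T.cell r).actBaseChange F l (T.centralIdem F l) = LinearMap.id :=
  ((T.cell r).actBaseChange_eq_id_iff F l _).mpr (T.isLayerIdem_centralIdem l).act_eq

/-- `A_0^F` is `F`, whose only nonzero idempotent is `1`. This matches the value `1` of `gzIdem` at
level `0`. -/
theorem centralIdem_zero (l : T.Shape 0) : T.centralIdem F l = 1 := by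
  have hk : ∀ x : T.AF F 0, ∃ k : F, x = algebraMap F _ k := by
    intro x
    induction x using TensorProduct.induction_on with
    | zero => exact ⟨0, by simp⟩
    | add x y hx hy =>
      obtain ⟨k, rfl⟩ := hx
      obtain ⟨j, rfl⟩ := hy
      exact ⟨k + j, (map_add _ _ _).symm⟩
    | tmul k a =>
      obtain ⟨c, rfl⟩ := T.zero_bijective.2 a
      refine ⟨c • k, ?_⟩
      rw [Algebra.TensorProduct.algebraMap_apply, Algebra.algebraMap_eq_smul_one,
        ← TensorProduct.smul_tmul]
      rfl
  have hz := T.isLayerIdem_centralIdem l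
  have : Nonempty (((T.cell 0).baseChange F).Idx l) := T.nonempty_idx 0 l
  have hne := hz.isMinimalCentralIdempotent.2.2.1
  obtain ⟨k, hkz⟩ := hk (T.centralIdem F l)
  have hidem := T.centralIdem_idem l
  by_cases h0 : k = 0
  · rw [h0, map_zero] at hkz
    exact absurd hkz hne
  · have hinv : algebraMap F (T.AF F 0) k⁻¹ * T.centralIdem F l = 1 := by
      rw [hkz, ← map_mul, inv_mul_cancel₀ h0, map_one]
    rw [← hinv]
    conv_lhs => rw [← one_mul (T.centralIdem F l), ← hinv, mul_assoc, hidem]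

theorem gzIdem_mul_centralIdem {r : ℕ} {l : T.Shape r} (t : T.Std l) :
    T.gzIdem F t * T.centralIdem F l = T.gzIdem F t := by
  cases t with
  | nil => rw [centralIdem_zero, mul_one]
  | @snoc r k l t h =>
    change _ * T.centralIdem F l * T.centralIdem F l = _ * T.centralIdem F l
    rw [mul_assoc, centralIdem_idem]

theorem gzIdem_mul_centralIdem_of_ne {r : ℕ} {l k : T.Shape r} (t : T.Std l) (h : l ≠ k) :
    T.gzIdem F t * T.centralIdem F k = 0 := by
  rw [← gzIdem_mul_centralIdem, mul_assoc, centralIdem_mul_eq_zero T h, mul_zero]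

theorem invF_mul {r : ℕ} (a b : T.AF F r) :
    T.invF F r (a * b) = T.invF F r b * T.invF F r a :=
  ((T.cell r).isCellularBasis_baseChange F).inv_mul a b

theorem invF_invF {r : ℕ} (a : T.AF F r) : T.invF F r (T.invF F r a) = a :=
  ((T.cell r).isCellularBasis_baseChange F).inv_inv a

theorem invF_tmul {r : ℕ} (k : F) (a : T.A r) :
    T.invF F r (k ⊗ₜ a) = k ⊗ₜ (T.cell r).inv a := rfl

theorem inclF_tmul {r : ℕ} (k : F) (a : T.A r) :
    T.inclF F r (k ⊗ₜ a) = k ⊗ₜ T.incl r a := rfl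

theorem inclF_invF {r : ℕ} (a : T.AF F r) :
    T.inclF F r (T.invF F r a) = T.invF F (r + 1) (T.inclF F r a) := by
  induction a using TensorProduct.induction_on with
  | zero => simp
  | add x y hx hy => simp only [map_add, hx, hy]
  | tmul k a => rw [invF_tmul, inclF_tmul, inclF_tmul, invF_tmul, T.incl_inv]

theorem invF_gzIdem : ∀ {r : ℕ} {l : T.Shape r} (t : T.Std l),
    T.invF F r (T.gzIdem F t) = T.gzIdem F t
  | 0, _, .nil l => by
    change T.invF F 0 (1 ⊗ₜ 1) = 1 ⊗ₜ 1
    rw [invF_tmul, (T.cell 0).inv_one]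
  | _ + 1, m, .snoc t h => by
    change T.invF F _ (T.inclF F _ (T.gzIdem F t) * T.centralIdem F m) =
      T.inclF F _ (T.gzIdem F t) * T.centralIdem F m
    rw [invF_mul, invF_centralIdem, ← inclF_invF, invF_gzIdem t, centralIdem_comm]

/-- The element `d_t F_t` of `A_r^F`. -/
noncomputable def gzPath {r : ℕ} {l : T.Shape r} (t : T.Std l) : T.AF F r :=
  1 ⊗ₜ[R] T.dPath t * T.gzIdem F t

theorem seminormalCell_eq {r : ℕ} (l : T.Shape r) (t : T.Std l) :
    T.seminormalCell l t = (T.cell r).actBaseChange F l (T.gzPath t) (1 ⊗ₜ T.δ r l) := by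
  rw [gzPath, CellDatum.actBaseChange_mul, CellDatum.actBaseChange_tmul, one_mul]
  rfl

theorem seminormalCell_snoc {r : ℕ} {l : T.Shape r} {m : T.Shape (r + 1)} (t : T.Std l)
    (h : T.Edge l m) :
    T.seminormalCell m (.snoc t h) = (T.cell (r + 1)).actBaseChange F m
      (T.inclF F r (T.gzPath t)) (1 ⊗ₜ (T.cell (r + 1)).act m (T.d h) (T.δ (r + 1) m)) := by
  change (T.cell (r + 1)).actBaseChange F m (T.inclF F r (T.gzIdem F t) * T.centralIdem F m)
    (1 ⊗ₜ (T.cell (r + 1)).act m (T.d h * T.incl r (T.dPath t)) (T.δ (r + 1) m)) = _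
  rw [CellDatum.actBaseChange_mul, act_centralIdem, gzPath, map_mul (T.inclF F r),
    CellDatum.actBaseChange_mul, inclF_tmul, CellDatum.actBaseChange_tmul, one_mul,
    CellDatum.act_mul_apply]
  rfl

variable [IsDomain R] [IsFractionRing R F]

/-- The map from `M (i + 1)` to `Δ(l)` is `A_r`-linear and sends `δ(m) d` to `δ(l)`, so annihilators
pass from the first to the second; denominators are cleared to work over `R`. -/
theorem act_eq_zero_of_edge {r : ℕ} {l : T.Shape r} {m : T.Shape (r + 1)} (h : T.Edge l m)
    (a : T.AF F r) (ha : (T.cell (r + 1)).actBaseChange F m (T.inclF F r a)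
      (1 ⊗ₜ (T.cell (r + 1)).act m (T.d h) (T.δ (r + 1) m)) = 0) :
    (T.cell r).actBaseChange F l a (1 ⊗ₜ T.δ r l) = 0 := by
  obtain ⟨c, hc, b, hb⟩ := exists_smul_eq_one_tmul a
  have hc1 : algebraMap R F c ≠ 0 := by simpa using hc
  suffices h : (T.cell r).act l b (T.δ r l) = 0 by
    have h1 : (T.cell r).actBaseChange F l (algebraMap R F c • a) (1 ⊗ₜ T.δ r l) = 0 := by
      rw [hb, CellDatum.actBaseChange_tmul, h, TensorProduct.tmul_zero]
    rw [map_smul, LinearMap.smul_apply] at h1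
    exact (smul_eq_zero.mp h1).resolve_left hc1
  have h1 : (T.cell (r + 1)).act m (T.incl r b)
      ((T.cell (r + 1)).act m (T.d h) (T.δ (r + 1) m)) = 0 := by
    apply one_tmul_finsupp_injective (F := F)
    rw [← one_mul (1 : F), ← CellDatum.actBaseChange_tmul, ← inclF_tmul, ← hb, map_smul, map_smul,
      LinearMap.smul_apply, ha, smul_zero]
  obtain ⟨f, _, i, rfl, hmem, hiso⟩ := T.isBranchingFactor h
  have h2 := f.iso_act i b ⟨_, hmem⟩
  rw [hiso] at h2
  rw [← h2]
  refine (congrArg (f.iso i) ((Submodule.Quotient.mk_eq_zero _).mpr ?_)).trans (map_zero _)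
  change T.resAct m b _ ∈ f.M i.castSucc
  have h3 : T.resAct m b ((T.cell (r + 1)).act m (T.d h) (T.δ (r + 1) m)) = 0 := h1
  rw [h3]
  exact Submodule.zero_mem _

end DiagramSequence

/-! ### Ranks of filtered modules and enumeration of paths -/

theorem le_sum_of_le_add {n : ℕ} (g : Fin (n + 1) → Cardinal) (s : Fin n → ℕ) (h0 : g 0 = 0)
    (h : ∀ i : Fin n, g i.succ ≤ s i + g i.castSucc) :
    g (Fin.last n) ≤ ((∑ i, s i : ℕ) : Cardinal) := by
  induction n with
  | zero => simp [show Fin.last 0 = 0 from rfl, h0]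
  | succ n ih =>
    have h1 := ih (fun i => g i.castSucc) (fun i => s i.castSucc) h0
      fun i => by simpa using h i.castSucc
    have h2 := h (Fin.last n)
    refine (h2.trans (add_le_add le_rfl h1)).trans_eq ?_
    rw [Fin.sum_univ_castSucc, Nat.cast_add, add_comm]

namespace CellDatum

theorem CellFiltration.rank_le {R : Type uR} {A : Type uA} [CommRing R] [IsDomain R] [Ring A]
    [Algebra R A] {D : CellDatum.{uR, uA, uL, uS} R A} {V : Type (max uR uS)} [AddCommGroup V]
    [Module R V] {ρ : A →ₗ[R] Module.End R V} (f : D.CellFiltration ρ) :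
    Module.rank R V ≤ ((∑ i, Nat.card (D.Idx (f.shape i)) : ℕ) : Cardinal) := by
  have h := le_sum_of_le_add (fun i => Module.rank R (f.M i))
    (fun i => Nat.card (D.Idx (f.shape i))) (by rw [f.bot]; simp) fun i => by
      have : Fintype (D.Idx (f.shape i)) := Fintype.ofFinite _
      have h1 := Submodule.rank_quotient_add_rank ((f.M i.castSucc).submoduleOf (f.M i.succ))
      rw [(f.iso i).rank_eq, (Submodule.submoduleOfEquivOfLe (f.mono i)).rank_eq] at h1
      rw [← h1]
      simp
  rw [f.top, rank_top] at h
  exact h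

end CellDatum

namespace CellularTower

variable {R : Type uR} [CommRing R] (T : CellularTower.{uR, uA, uL, uS} R)

/-- A path of length `r + 1` is an edge into its end point together with a path of length `r`. -/
def pathSuccEquiv {r : ℕ} (m : T.Shape (r + 1)) :
    T.Path (r + 1) m ≃ Σ e : {l : T.Shape r // T.Edge l m}, T.Path r e.1 where
  toFun t := match t with
    | .snoc (l := l) t h => ⟨⟨l, h⟩, t⟩
  invFun p := .snoc p.2 p.1.2
  left_inv t := by cases t; rfl
  right_inv p := rfl

instance (l : T.Shape 0) : Unique (T.Path 0 l) where
  default := .nil l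
  uniq t := by cases t; rfl

end CellularTower

/-! ### The seminormal basis of a cell module -/

namespace DiagramSequence

variable {R : Type uR} {F : Type uF} [CommRing R] [Field F] [Algebra R F]
  (T : DiagramSequence.{uR, uF, uA, uL, uS} R F)

theorem finrank_cellModuleF {r : ℕ} (l : T.Shape r) :
    Module.finrank F (T.CellModuleF F l) = Nat.card ((T.cell r).Idx l) := by
  have : Fintype ((T.cell r).Idx l) := Fintype.ofFinite _
  rw [((T.cell r).cellModuleEquiv F l).finrank_eq, Nat.card_eq_fintype_card]
  exact Module.finrank_finsupp_self F

instance {r : ℕ} (l : T.Shape r) : Module.Finite F (T.CellModuleF F l) :=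
  have : Module.Finite F (((T.cell r).baseChange F).CellModule l) :=
    inferInstanceAs (Module.Finite F ((T.cell r).Idx l →₀ F))
  Module.Finite.equiv ((T.cell r).cellModuleEquiv F l).symm

theorem act_inclF_centralIdem_snoc {r : ℕ} {l : T.Shape r} {m : T.Shape (r + 1)} (k : T.Shape r)
    (t : T.Std l) (h : T.Edge l m) :
    (T.cell (r + 1)).actBaseChange F m (T.inclF F r (T.centralIdem F k))
      (T.seminormalCell m (.snoc t h)) = (T.cell (r + 1)).actBaseChange F m
      (T.inclF F r (T.gzPath t * T.centralIdem F k))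
      (1 ⊗ₜ (T.cell (r + 1)).act m (T.d h) (T.δ (r + 1) m)) := by
  rw [seminormalCell_snoc, ← CellDatum.actBaseChange_mul, ← map_mul]

variable [IsDomain R]

theorem δ_ne_zero {r : ℕ} (l : T.Shape r) : T.δ r l ≠ 0 := by
  intro h
  obtain ⟨i⟩ := T.nonempty_idx r l
  obtain ⟨a, ha⟩ := T.δ_generates r l (Finsupp.single i 1)
  rw [h, map_zero] at ha
  exact Finsupp.single_ne_zero.mpr one_ne_zero ha.symm

theorem card_idx_zero_le (l : T.Shape 0) : Nat.card ((T.cell 0).Idx l) ≤ 1 := by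
  have : Fintype ((T.cell 0).Idx l) := Fintype.ofFinite _
  have h : Module.finrank R (T.CellModule l) ≤ 1 := by
    refine finrank_le_one (T.δ 0 l) fun w => ?_
    obtain ⟨a, rfl⟩ := T.δ_generates 0 l w
    obtain ⟨c, rfl⟩ := T.zero_bijective.2 a
    refine ⟨c, ?_⟩
    rw [Algebra.algebraMap_eq_smul_one, map_smul, CellDatum.act_one]
    rfl
  rw [Nat.card_eq_fintype_card]
  simpa using h

variable [IsFractionRing R F]

theorem linearIndependent_seminormalCell_zero (l : T.Shape 0) :
    LinearIndependent F (T.seminormalCell l) := by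
  refine linearIndependent_unique_iff.mpr ?_
  have h : T.seminormalCell l (.nil l) = 1 ⊗ₜ[R] T.δ 0 l := by
    rw [seminormalCell_eq]
    change (T.cell 0).actBaseChange F l (1 ⊗ₜ[R] (1 : T.A 0) * 1) _ = _
    rw [mul_one, CellDatum.actBaseChange_tmul, CellDatum.act_one, one_mul]
    rfl
  change T.seminormalCell l (.nil l) ≠ 0
  rw [h]
  exact fun h0 => T.δ_ne_zero l (one_tmul_finsupp_injective h0)

/-- The blocks are the edges into `m`, with the `z_l` of level `r` as projections. Within a block,
`act_eq_zero_of_edge` reduces a relation to the induction hypothesis. -/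
theorem linearIndependent_seminormalCell_succ {r : ℕ}
    (ih : ∀ l : T.Shape r, LinearIndependent F (T.seminormalCell l)) (m : T.Shape (r + 1)) :
    LinearIndependent F (T.seminormalCell m) := by
  rw [← linearIndependent_equiv (T.pathSuccEquiv m).symm]
  refine linearIndependent_sigma_of_proj _ (fun e => (T.cell (r + 1)).actBaseChange F m
    (T.inclF F r (T.centralIdem F e.1))) (fun e => ?_) (fun e e' hne t => ?_)
  · have hfun : (fun t : T.Std e.1 => (T.cell (r + 1)).actBaseChange F m
        (T.inclF F r (T.centralIdem F e.1)) (T.seminormalCell m (.snoc t e.2))) =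
        fun t => ((LinearMap.applyₗ (R := F) (1 ⊗ₜ (T.cell (r + 1)).act m (T.d e.2)
          (T.δ (r + 1) m) : T.CellModuleF F m)) ∘ₗ (T.cell (r + 1)).actBaseChange F m ∘ₗ
          (T.inclF F r).toLinearMap) (T.gzPath t) := by
      funext t
      rw [act_inclF_centralIdem_snoc, gzPath, mul_assoc, gzIdem_mul_centralIdem]
      rfl
    change LinearIndependent F (fun t : T.Std e.1 => (T.cell (r + 1)).actBaseChange F m
        (T.inclF F r (T.centralIdem F e.1)) (T.seminormalCell m (.snoc t e.2)))
    rw [hfun]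
    refine linearIndependent_map_of_ker_le _
      (LinearMap.applyₗ (R := F) (1 ⊗ₜ T.δ r e.1 : T.CellModuleF F e.1) ∘ₗ
        (T.cell r).actBaseChange F e.1) (fun a ha => T.act_eq_zero_of_edge e.2 a ha) _ ?_
    have hi := ih e.1
    rw [show T.seminormalCell e.1 = _ from funext (T.seminormalCell_eq e.1)] at hi
    exact hi
  · change (T.cell (r + 1)).actBaseChange F m
      (T.inclF F r (T.centralIdem F e.1)) (T.seminormalCell m (.snoc t e'.2)) = 0
    rw [act_inclF_centralIdem_snoc, gzPath, mul_assoc,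
      gzIdem_mul_centralIdem_of_ne T t (fun h => hne (Subtype.ext h.symm)), mul_zero, map_zero,
      map_zero]
    rfl

theorem linearIndependent_seminormalCell : ∀ {r : ℕ} (l : T.Shape r),
    LinearIndependent F (T.seminormalCell l)
  | 0, l => T.linearIndependent_seminormalCell_zero l
  | _ + 1, m => T.linearIndependent_seminormalCell_succ
      (fun l => linearIndependent_seminormalCell l) m

theorem finite_std {r : ℕ} (l : T.Shape r) : Finite (T.Std l) :=
  (T.linearIndependent_seminormalCell l).finite

theorem card_idx_succ_le {r : ℕ}
    (ih : ∀ l : T.Shape r, Nat.card ((T.cell r).Idx l) ≤ Nat.card (T.Std l))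
    (m : T.Shape (r + 1)) : Nat.card ((T.cell (r + 1)).Idx m) ≤ Nat.card (T.Std m) := by
  classical
  obtain ⟨f, hf⟩ := T.restrictionCoherent r m
  have : Fintype (T.Shape r) := Fintype.ofFinite _
  have : ∀ l : T.Shape r, Finite (T.Std l) := T.finite_std
  have h1 : Nat.card ((T.cell (r + 1)).Idx m) ≤ ∑ i, Nat.card ((T.cell r).Idx (f.shape i)) := by
    have : Fintype ((T.cell (r + 1)).Idx m) := Fintype.ofFinite _
    have h := f.rank_le
    rw [← Nat.cast_le (α := Cardinal)]
    refine le_trans ?_ h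
    simp
  refine h1.trans ?_
  rw [Nat.card_congr (T.pathSuccEquiv m), Nat.card_sigma]
  let φ : Fin f.len → {l : T.Shape r // T.Edge l m} := fun i => ⟨f.shape i, f, hf, i, rfl⟩
  -- Order preservation makes the shapes strictly decreasing, so each edge is counted at most once.
  have hφ : Function.Injective φ := fun i j h => hf.injective (congrArg Subtype.val h)
  calc ∑ i, Nat.card ((T.cell r).Idx (f.shape i))
      ≤ ∑ i, Nat.card (T.Path r (φ i).1) := Finset.sum_le_sum fun i _ => ih _
    _ = ∑ e ∈ Finset.univ.map (⟨φ, hφ⟩ : Fin f.len ↪ {l : T.Shape r // T.Edge l m}),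
        Nat.card (T.Path r e.1) := by
      rw [Finset.sum_map]; rfl
    _ ≤ ∑ e : {l : T.Shape r // T.Edge l m}, Nat.card (T.Path r e.1) :=
      Finset.sum_le_sum_of_subset (Finset.subset_univ _)

theorem card_idx_le : ∀ {r : ℕ} (l : T.Shape r),
    Nat.card ((T.cell r).Idx l) ≤ Nat.card (T.Std l)
  | 0, l => (T.card_idx_zero_le l).trans (by simp)
  | _ + 1, m => T.card_idx_succ_le (fun l => card_idx_le l) m

theorem card_std {r : ℕ} (l : T.Shape r) :
    Nat.card (T.Std l) = Nat.card ((T.cell r).Idx l) := by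
  have := T.finite_std l
  have : Fintype (T.Std l) := Fintype.ofFinite _
  refine le_antisymm ?_ (T.card_idx_le l)
  rw [← finrank_cellModuleF, Nat.card_eq_fintype_card]
  exact (T.linearIndependent_seminormalCell l).fintype_card_le_finrank

theorem exists_basis_seminormalCell {r : ℕ} (l : T.Shape r) :
    ∃ b : Module.Basis (T.Std l) F (T.CellModuleF F l), ∀ t, b t = T.seminormalCell l t := by
  have := T.finite_std l
  have : Fintype (T.Std l) := Fintype.ofFinite _
  have : Nonempty (T.Std l) := by
    rw [← Finite.card_pos_iff, card_std]
    have := T.nonempty_idx r l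
    exact Finite.card_pos
  refine ⟨basisOfLinearIndependentOfCardEqFinrank (T.linearIndependent_seminormalCell l) ?_,
    fun t => by rw [coe_basisOfLinearIndependentOfCardEqFinrank]⟩
  rw [finrank_cellModuleF, ← card_std, Nat.card_eq_fintype_card]

end DiagramSequence

/-! ### The bimodule isomorphism over the field -/

theorem eq_zero_of_mem_span_of_map_eq_zero {K V W ι : Type*} [Semiring K] [AddCommMonoid V]
    [Module K V] [AddCommMonoid W] [Module K W] (φ : V →ₗ[K] W) (v : ι → V)
    (hv : LinearIndependent K fun i => φ (v i)) {y : V} (hy : y ∈ Submodule.span K (Set.range v))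
    (h : φ y = 0) : y = 0 := by
  rw [← Finsupp.range_linearCombination] at hy
  obtain ⟨g, rfl⟩ := hy
  rw [Finsupp.apply_linearCombination] at h
  have hg : g = 0 := hv (h.trans (map_zero _).symm)
  rw [hg, map_zero]

namespace CellDatum

variable {R : Type uR} {A : Type uA} [CommRing R] [Ring A] [Algebra R A]
  {D : CellDatum.{uR, uA, uL, uS} R A}

open scoped Classical in
/-- The projection of `A` onto `A^{⊵ l}` along the remaining elements of the cellular basis. -/
noncomputable def geProj (D : CellDatum.{uR, uA, uL, uS} R A) (l : D.Shape) : A →ₗ[R] D.ge l :=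
  D.basis.constr R fun p => if h : l ≤ p.1 then ⟨D.c p.1 p.2.1 p.2.2, D.c_mem_ge h _ _⟩ else 0

theorem geProj_of_mem {l : D.Shape} {x : A} (hx : x ∈ D.ge l) : D.geProj l x = ⟨x, hx⟩ := by
  apply Subtype.ext
  change ((D.geProj l x : D.ge l) : A) = x
  induction hx using Submodule.span_induction with
  | mem x hx =>
    obtain ⟨k, hk, u, w, rfl⟩ := hx
    rw [c_eq_basis, geProj, Module.Basis.constr_basis, dif_pos hk, basis_apply]
  | zero => simp
  | add x y _ _ hx hy => rw [map_add, Submodule.coe_add, hx, hy]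
  | smul c x _ hx => rw [map_smul, Submodule.coe_smul, hx]

namespace BimoduleIso

variable {l : D.Shape} (α : D.BimoduleIso l) (F : Type uF) [Field F] [Algebra R F]

/-- The bimodule isomorphism as a map on `A^F`, extended by zero along the cellular basis. -/
noncomputable def extend : F ⊗[R] A →ₗ[F] (F ⊗[R] D.CellModule l) ⊗[F] (F ⊗[R] D.CellModule l) :=
  (TensorProduct.AlgebraTensorModule.distribBaseChange R F (D.CellModule l)
    (D.CellModule l)).toLinearMap ∘ₗ
    (α.toEquiv.toLinearMap ∘ₗ Submodule.mkQ _ ∘ₗ D.geProj l).baseChange F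

theorem extend_tmul {x : A} (hx : x ∈ D.ge l) (k : F) :
    α.extend F (k ⊗ₜ x) = TensorProduct.AlgebraTensorModule.distribBaseChange R F _ _
      (k ⊗ₜ α.toEquiv (Submodule.Quotient.mk ⟨x, hx⟩)) := by
  simp [extend, geProj_of_mem hx]

theorem extend_mul {x : A} (hx : x ∈ D.ge l) (a b : F ⊗[R] A) :
    α.extend F (a * (1 ⊗ₜ x) * b) =
      TensorProduct.map (D.actBaseChange F l (D.inv.baseChange F a)) (D.actBaseChange F l b)
        (α.extend F (1 ⊗ₜ x)) := by
  induction a using TensorProduct.induction_on with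
  | zero => simp
  | add a a' ha ha' => simp only [add_mul, map_add, ha, ha', TensorProduct.map_add_left,
      LinearMap.add_apply]
  | tmul k a =>
    induction b using TensorProduct.induction_on with
    | zero => simp
    | add b b' hb hb' => simp only [mul_add, map_add, hb, hb', TensorProduct.map_add_right,
        LinearMap.add_apply]
    | tmul j b =>
      have hm : a * x * b ∈ D.ge l := D.ge_mul_mem (D.mul_ge_mem hx a) b
      rw [Algebra.TensorProduct.tmul_mul_tmul, Algebra.TensorProduct.tmul_mul_tmul, mul_one,
        extend_tmul α F hm, extend_tmul α F hx, α.map_mul a b ⟨x, hx⟩ ⟨_, hm⟩ rfl]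
      generalize α.toEquiv (Submodule.Quotient.mk ⟨x, hx⟩) = y
      induction y using TensorProduct.induction_on with
      | zero => simp
      | add y y' hy hy' => simp only [TensorProduct.tmul_add, map_add, hy, hy']
      | tmul u v =>
        simp only [TensorProduct.map_tmul, LinearMap.baseChange_tmul,
          TensorProduct.AlgebraTensorModule.distribBaseChange_tmul, actBaseChange_tmul]
        -- The scalars `k` and `j` land in different tensor factors; both are collected in the
        -- first.
        rw [mul_one, mul_one, mul_comm k j, ← smul_eq_mul j k, ← TensorProduct.smul_tmul',
          TensorProduct.smul_tmul, TensorProduct.smul_tmul', smul_eq_mul, mul_one]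

end BimoduleIso

end CellDatum

/-! ### The seminormal basis of the algebra -/

namespace DiagramSequence

variable {R : Type uR} {F : Type uF} [CommRing R] [Field F] [Algebra R F]
  (T : DiagramSequence.{uR, uF, uA, uL, uS} R F)

/-- As `F_s` is fixed by the involution, `F_s d_s*` is `(d_s F_s)*`; this puts `m_l` in the middle,
where `extend_mul` applies. -/
theorem seminormal_eq {r : ℕ} (l : T.Shape r) (s t : T.Std l) :
    T.seminormal l s t =
      T.invF F r (T.gzPath s) * (1 ⊗ₜ (T.gen r l : T.A r)) * T.gzPath t := by
  rw [gzPath, gzPath, invF_mul, invF_gzIdem, invF_tmul]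
  simp only [seminormal, murphy, mul_assoc]
  rw [← mul_assoc (1 ⊗ₜ[R] (T.cell r).inv _), ← mul_assoc (_ ⊗ₜ[R] _ * _),
    Algebra.TensorProduct.tmul_mul_tmul, Algebra.TensorProduct.tmul_mul_tmul, one_mul, one_mul,
    mul_assoc]

theorem extend_seminormal_mul {r : ℕ} (l : T.Shape r) (s t : T.Std l) (a : T.AF F r) :
    (T.α r l).extend F (T.seminormal l s t * a) =
      T.seminormalCell l s ⊗ₜ (T.cell r).actBaseChange F l a (T.seminormalCell l t) := by
  rw [seminormal_eq, mul_assoc, CellDatum.BimoduleIso.extend_mul _ _ (T.gen r l).2,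
    CellDatum.BimoduleIso.extend_tmul _ _ (T.gen r l).2, T.α_gen,
    TensorProduct.AlgebraTensorModule.distribBaseChange_tmul, TensorProduct.map_tmul,
    seminormalCell_eq, seminormalCell_eq, CellDatum.actBaseChange_mul]
  change (T.cell r).actBaseChange F l (T.invF F r (T.invF F r (T.gzPath s))) _ ⊗ₜ _ = _
  rw [invF_invF]

theorem extend_seminormal {r : ℕ} (l : T.Shape r) (s t : T.Std l) :
    (T.α r l).extend F (T.seminormal l s t) = T.seminormalCell l s ⊗ₜ T.seminormalCell l t := by
  have h := T.extend_seminormal_mul l s t 1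
  rwa [mul_one, CellDatum.actBaseChange_one] at h

theorem invF_seminormal {r : ℕ} (l : T.Shape r) (s t : T.Std l) :
    T.invF F r (T.seminormal l s t) = T.seminormal l t s := by
  rw [seminormal_eq, seminormal_eq, invF_mul, invF_mul, invF_invF, invF_tmul, T.inv_gen, mul_assoc]

theorem seminormal_mul_centralIdem {r : ℕ} (l : T.Shape r) (s t : T.Std l) :
    T.seminormal l s t * T.centralIdem F l = T.seminormal l s t := by
  rw [seminormal, mul_assoc, gzIdem_mul_centralIdem]

theorem seminormal_mul_centralIdem_of_ne {r : ℕ} {l k : T.Shape r} (s t : T.Std l) (h : l ≠ k) :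
    T.seminormal l s t * T.centralIdem F k = 0 := by
  rw [seminormal, mul_assoc, gzIdem_mul_centralIdem_of_ne T t h, mul_zero]

variable [IsDomain R] [IsFractionRing R F]

theorem linearIndependent_extend_seminormal {r : ℕ} (l : T.Shape r) : LinearIndependent F
    fun p : T.Std l × T.Std l => (T.α r l).extend F (T.seminormal l p.1 p.2) := by
  obtain ⟨b, hb⟩ := T.exists_basis_seminormalCell l
  have h := (b.tensorProduct b).linearIndependent
  have e : ⇑(b.tensorProduct b) = fun p : T.Std l × T.Std l =>
      (T.α r l).extend F (T.seminormal l p.1 p.2) := by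
    funext p
    rw [extend_seminormal, Module.Basis.tensorProduct_apply', hb, hb]
  rw [e] at h
  exact h

theorem linearIndependent_seminormal (r : ℕ) : LinearIndependent F
    fun p : (Σ l : T.Shape r, T.Std l × T.Std l) => T.seminormal p.1 p.2.1 p.2.2 := by
  refine linearIndependent_sigma_of_proj
    (W := fun l => T.CellModuleF F l ⊗[F] T.CellModuleF F l) _ (fun l => (T.α r l).extend F ∘ₗ
    LinearMap.mulRight F (T.centralIdem F l)) (fun l => ?_) (fun l k h p => ?_)
  · have h := T.linearIndependent_extend_seminormal l
    have e : (fun p : T.Std l × T.Std l => (T.α r l).extend F (T.seminormal l p.1 p.2)) =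
        fun p : T.Std l × T.Std l =>
          ((T.α r l).extend F ∘ₗ LinearMap.mulRight F (T.centralIdem F l))
            (T.seminormal l p.1 p.2) := by
      funext p
      rw [LinearMap.comp_apply, LinearMap.mulRight_apply, seminormal_mul_centralIdem]
    rw [e] at h
    exact h
  · rw [LinearMap.comp_apply, LinearMap.mulRight_apply,
      seminormal_mul_centralIdem_of_ne T _ _ h.symm, map_zero]

theorem exists_basis_seminormal (r : ℕ) :
    ∃ b : Module.Basis (Σ l : T.Shape r, T.Std l × T.Std l) F (T.AF F r),
      ∀ p, b p = T.seminormal p.1 p.2.1 p.2.2 := by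
  have : ∀ l : T.Shape r, Finite (T.Std l) := T.finite_std
  have : Fintype (T.Shape r) := Fintype.ofFinite _
  have : Fintype (Σ l : T.Shape r, T.Std l × T.Std l) := Fintype.ofFinite _
  have : Fintype (Σ l : T.Shape r, (T.cell r).Idx l × (T.cell r).Idx l) := Fintype.ofFinite _
  have hcard : Fintype.card (Σ l : T.Shape r, T.Std l × T.Std l) =
      Module.finrank F (T.AF F r) := by
    rw [Module.finrank_eq_card_basis ((T.cell r).baseChange F).basis, ← Nat.card_eq_fintype_card,
      ← Nat.card_eq_fintype_card, Nat.card_sigma, Nat.card_sigma]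
    simp only [Nat.card_prod, card_std]
  have hli := T.linearIndependent_seminormal r
  have : Module.Finite F (T.AF F r) := Module.Finite.of_basis ((T.cell r).baseChange F).basis
  refine ⟨Module.Basis.mk hli (hli.span_eq_top_of_card_eq_finrank' hcard).ge, fun p => ?_⟩
  rw [Module.Basis.mk_apply]

theorem mul_centralIdem_mem_span {r : ℕ} (l : T.Shape r) (y : T.AF F r) :
    y * T.centralIdem F l ∈
      Submodule.span F (Set.range fun p : T.Std l × T.Std l => T.seminormal l p.1 p.2) := by
  obtain ⟨b, hb⟩ := T.exists_basis_seminormal r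
  have hmem : ∀ x ∈ Submodule.span F (Set.range b), x * T.centralIdem F l ∈
      Submodule.span F (Set.range fun p : T.Std l × T.Std l => T.seminormal l p.1 p.2) := by
    intro x hx
    induction hx using Submodule.span_induction with
    | mem x hx =>
      obtain ⟨⟨k, s, t⟩, rfl⟩ := hx
      rw [hb]
      by_cases hk : k = l
      · subst hk
        rw [seminormal_mul_centralIdem]
        exact Submodule.subset_span ⟨(s, t), rfl⟩
      · rw [seminormal_mul_centralIdem_of_ne T s t hk]
        exact Submodule.zero_mem _
    | zero => simp
    | add x y _ _ hx hy => rw [add_mul]; exact Submodule.add_mem _ hx hy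
    | smul c x _ hx => rw [smul_mul_assoc]; exact Submodule.smul_mem _ _ hx
  exact hmem y (b.mem_span y)

/-- `A^F z_l` is spanned by the `F_st` of shape `l`, whose images `f_s ⊗ f_t` are independent. -/
theorem eq_zero_of_extend_eq_zero {r : ℕ} {l : T.Shape r} {y : T.AF F r}
    (hy : y * T.centralIdem F l = y) (h : (T.α r l).extend F y = 0) : y = 0 :=
  eq_zero_of_mem_span_of_map_eq_zero ((T.α r l).extend F)
    (fun p : T.Std l × T.Std l => T.seminormal l p.1 p.2)
    (T.linearIndependent_extend_seminormal l) (hy ▸ T.mul_centralIdem_mem_span l y) h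

theorem seminormal_mul {r : ℕ} (l : T.Shape r) (t : T.Std l) (a : T.AF F r) :
    ∃ q : T.Std l →₀ F, ∀ s : T.Std l,
      T.seminormal l s t * a = q.sum fun v k => k • T.seminormal l s v := by
  obtain ⟨b, hb⟩ := T.exists_basis_seminormalCell l
  -- The coordinates of `f_t · a` in the seminormal basis, which do not involve `s`.
  refine ⟨b.repr ((T.cell r).actBaseChange F l a (T.seminormalCell l t)), fun s => ?_⟩
  rw [← sub_eq_zero]
  refine T.eq_zero_of_extend_eq_zero (l := l) ?_ ?_
  · rw [sub_mul, mul_assoc, centralIdem_comm, ← mul_assoc, seminormal_mul_centralIdem,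
      Finsupp.sum, Finset.sum_mul]
    simp only [smul_mul_assoc, seminormal_mul_centralIdem]
  · rw [map_sub, extend_seminormal_mul, Finsupp.sum, map_sum]
    simp only [map_smul, extend_seminormal]
    have e := b.linearCombination_repr ((T.cell r).actBaseChange F l a (T.seminormalCell l t))
    rw [Finsupp.linearCombination_apply, Finsupp.sum] at e
    rw [sub_eq_zero, ← e, TensorProduct.tmul_sum, e]
    simp only [TensorProduct.tmul_smul, hb]

end DiagramSequence

end Cellular

theorem mainTheorem10 {R F : Type*} [CommRing R] [IsDomain R] [Field F] [Algebra R F]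
    [IsFractionRing R F] (T : Cellular.DiagramSequence R F) (r : ℕ) :
    (∀ l : T.Shape r, ∃ b : Module.Basis (T.Std l) F (T.CellModuleF F l),
      ∀ t : T.Std l, b t = T.seminormalCell l t) ∧
    Cellular.IsCellularBasis (L := T.Shape r) (S := fun l => T.Std l) (T.invF F r)
      (fun l s t => T.seminormal l s t) := by
  refine ⟨fun l => T.exists_basis_seminormalCell l, T.invF_mul, T.invF_invF, inferInstance,
    fun l => T.finite_std l, T.linearIndependent_seminormal r, ?_, fun l t a => ?_,
    fun l s t => ?_⟩
  · obtain ⟨b, hb⟩ := T.exists_basis_seminormal r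
    have h := b.span_eq
    rwa [show ⇑b = _ from funext hb] at h
  · obtain ⟨q, hq⟩ := T.seminormal_mul l t a
    exact ⟨q, fun s => by rw [hq s, sub_self]; exact Submodule.zero_mem _⟩
  · rw [T.invF_seminormal, sub_self]
    exact Submodule.zero_mem _
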